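/- Consider three parties $A_1,A_2,A_3$ sharing a pure state $|\psi\rangle\in\mathbb C^{d_1}\otimes\mathbb C^{d_2}\otimes\mathbb C^{d_3}$ of arbitrary finite local dimensions. Each party $A_i$ has two measurements $x_i\in\{0,1\}$ (written $A_i^0,A_i^1$) with outcomes $a_i\in\{+1,-1\}$, given by positive semidefinite operators $\Pi_{a_i|x_i}$ with $\Pi_{+1|x_i}+\Pi_{-1|x_i}=\mathbb 1$. Let $P(a_1,a_2,a_3|x_1,x_2,x_3)=\langle\psi|\Pi_{a_1|x_1}\otimes\Pi_{a_2|x_2}\otimes\Pi_{a_3|x_3}|\psi\rangle$. Suppose that the tripartite Hardy constraints $$P(+,+,+|1,0,0)=P(+,+,+|0,1,0)=P(+,+,+|0,0,1)=P(-,-,-|1,1,1)=0$$ hold, and let $p_3^H=P(+,+,+|0,0,0)$ be the Hardy success probability. Let $|GHZ\rangle=(|000\rangle+|111\rangle)/\sqrt2$, and for every party let $\widetilde\Pi_{a|x}=\frac12(\mathbb 1+a\widetilde A^x)$ with $$\widetilde A^0=\begin{pmatrix}0&e^{-i\pi/6}\\e^{i\pi/6}&0\end{pmatrix},\qquad \widetilde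 A^1=\begin{pmatrix}0&e^{-2i\pi/3}\\e^{2i\pi/3}&0\end{pmatrix}.$$ Then: 1. The maximum of $p_3^H$ over all such states and measurements satisfying the Hardy constraints is $\frac18$. 2. It is attained by $|GHZ\rangle$ with the measurements $\widetilde\Pi_{a|x}$. 3. Whenever the Hardy constraints hold and $p_3^H=\frac18$ is observed, the state is, up to local isometries, the GHZ state together with a junk state: there are isometries $\Phi_i:\mathbb C^{d_i}\to\mathbb C^{k_i}\otimes\mathbb C^2$ $(i=1,2,3)$ and a unit vector $|\varsigma\rangle\in\mathbb C^{k_1}\otimes\mathbb C^{k_2}\otimes\mathbb C^{k_3}$ such that, with $\Phi=\Phi_1\otimes\Phi_2\otimes\Phi_3$, $$\Phi|\psi\rangle=|\varsigma\rangle\otimes|GHZ\rangle,$$ and, for all outcomes $a_i$ and settings $x_i$, $$\Phi\big(\Pi_{a_1|x_1}\otimes\Pi_{a_2|x_2}\otimes\Pi_{a_3|x_3}|\psi\rangle\big)=|\varsigma\rangle\otimes\big(\widetilde\Pi_{a_1|x_1}\otimes\widetilde\Pi_{a_2|x_2}\otimes\widetilde\Pi_{a_3|x_3}|GHZ\rangle\big).$$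 That is, the maximal tripartite Hardy correlation self-tests the GHZ state. -/

import Mathlib

namespace HardyGHZ

open scoped Kronecker ComplexOrder

/-- A (possibly non-projective) measurement with outcomes `+1` and `-1` on `ℂⁿ`: positive
semidefinite operators adding up to the identity. Outcomes are the units `1, -1` of `ℤ`. -/
structure IsMeasurement {n : Type*} [Fintype n] [DecidableEq n]
    (M : ℤˣ → Matrix n n ℂ) : Prop where
  posSemidef : ∀ a, (M a).PosSemidef
  sum_eq_one : M 1 + M (-1) = 1

/-- A quantum realization of a Bell experiment with three parties, two settings per party and
outcomes `±1`: a pure tripartite state of `ℂ^{d₁} ⊗ ℂ^{d₂} ⊗ ℂ^{d₃}`, given by its amplitudes,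
and for each party a measurement for each of the two settings `0, 1`. -/
structure Realization (d₁ d₂ d₃ : ℕ) where
  state : Fin d₁ × Fin d₂ × Fin d₃ → ℂ
  meas₁ : Fin 2 → ℤˣ → Matrix (Fin d₁) (Fin d₁) ℂ
  meas₂ : Fin 2 → ℤˣ → Matrix (Fin d₂) (Fin d₂) ℂ
  meas₃ : Fin 2 → ℤˣ → Matrix (Fin d₃) (Fin d₃) ℂ
  norm_state : ∑ i, ‖state i‖ ^ 2 = 1
  isMeasurement₁ : ∀ x, IsMeasurement (meas₁ x)
  isMeasurement₂ : ∀ x, IsMeasurement (meas₂ x)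
  isMeasurement₃ : ∀ x, IsMeasurement (meas₃ x)

namespace Realization

variable {d₁ d₂ d₃ : ℕ}

/-- The vector `(Π_{a₁|x₁} ⊗ Π_{a₂|x₂} ⊗ Π_{a₃|x₃}) |ψ⟩`. -/
noncomputable def measured (R : Realization d₁ d₂ d₃) (a₁ a₂ a₃ : ℤˣ) (x₁ x₂ x₃ : Fin 2) :
    Fin d₁ × Fin d₂ × Fin d₃ → ℂ :=
  Matrix.mulVec (R.meas₁ x₁ a₁ ⊗ₖ (R.meas₂ x₂ a₂ ⊗ₖ R.meas₃ x₃ a₃)) R.state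

/-- The joint probability `P(a₁,a₂,a₃|x₁,x₂,x₃) = ⟨ψ|Π_{a₁|x₁} ⊗ Π_{a₂|x₂} ⊗ Π_{a₃|x₃}|ψ⟩`. -/
noncomputable def prob (R : Realization d₁ d₂ d₃) (a₁ a₂ a₃ : ℤˣ) (x₁ x₂ x₃ : Fin 2) : ℝ :=
  (star R.state ⬝ᵥ R.measured a₁ a₂ a₃ x₁ x₂ x₃).re

/-- The zero-probability constraints of the tripartite Hardy paradox. -/
structure SatisfiesHardy (R : Realization d₁ d₂ d₃) : Prop where
  zero₁ : R.prob 1 1 1 1 0 0 = 0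
  zero₂ : R.prob 1 1 1 0 1 0 = 0
  zero₃ : R.prob 1 1 1 0 0 1 = 0
  zero₄ : R.prob (-1) (-1) (-1) 1 1 1 = 0

/-- The Hardy success probability `p = P(+1,+1,+1|A₁⁰,A₂⁰,A₃⁰)`. -/
noncomputable def hardyProb (R : Realization d₁ d₂ d₃) : ℝ :=
  R.prob 1 1 1 0 0 0

/-- `R` is equivalent up to local isometries to the three-qubit realization `S`: there are local
isometries `Φᵢ : ℂ^{dᵢ} → ℂ^{kᵢ} ⊗ ℂ²` and a junk state `ς` of `ℂ^{k₁} ⊗ ℂ^{k₂} ⊗ ℂ^{k₃}` such that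
`Φ = Φ₁ ⊗ Φ₂ ⊗ Φ₃` takes the state of `R` to `ς ⊗` (the state of `S`), and likewise when all the
measurement operators are applied to the two states. -/
def EquivUpToLocalIsometries (R : Realization d₁ d₂ d₃) (S : Realization 2 2 2) : Prop :=
  ∃ (k₁ k₂ k₃ : ℕ)
    (Φ₁ : Matrix (Fin k₁ × Fin 2) (Fin d₁) ℂ)
    (Φ₂ : Matrix (Fin k₂ × Fin 2) (Fin d₂) ℂ)
    (Φ₃ : Matrix (Fin k₃ × Fin 2) (Fin d₃) ℂ)
    (ς : Fin k₁ × Fin k₂ × Fin k₃ → ℂ),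
    Φ₁.conjTranspose * Φ₁ = 1 ∧ Φ₂.conjTranspose * Φ₂ = 1 ∧ Φ₃.conjTranspose * Φ₃ = 1 ∧
    ∑ j, ‖ς j‖ ^ 2 = 1 ∧
    (∀ j₁ j₂ j₃ q₁ q₂ q₃,
      Matrix.mulVec (Φ₁ ⊗ₖ (Φ₂ ⊗ₖ Φ₃)) R.state ((j₁, q₁), (j₂, q₂), (j₃, q₃)) =
        ς (j₁, j₂, j₃) * S.state (q₁, q₂, q₃)) ∧
    (∀ a₁ a₂ a₃ x₁ x₂ x₃ j₁ j₂ j₃ q₁ q₂ q₃,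
      Matrix.mulVec (Φ₁ ⊗ₖ (Φ₂ ⊗ₖ Φ₃)) (R.measured a₁ a₂ a₃ x₁ x₂ x₃)
          ((j₁, q₁), (j₂, q₂), (j₃, q₃)) =
        ς (j₁, j₂, j₃) * S.measured a₁ a₂ a₃ x₁ x₂ x₃ (q₁, q₂, q₃))

end Realization

/-- The state `|GHZ⟩ = (|000⟩ + |111⟩) / √2`. -/
noncomputable def ghzState : Fin 2 × Fin 2 × Fin 2 → ℂ := fun q =>
  if q = (0, 0, 0) ∨ q = (1, 1, 1) then ((1 / Real.sqrt 2 : ℝ) : ℂ) else 0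

/-- The qubit observable with rows `(0, e^{-iθ})` and `(e^{iθ}, 0)`. -/
noncomputable def equatorial (θ : ℝ) : Matrix (Fin 2) (Fin 2) ℂ :=
  !![0, Complex.exp (-(θ * Complex.I)); Complex.exp (θ * Complex.I), 0]

/-- The two angles `π/6` and `2π/3` of the reference observables. -/
noncomputable def ghzAngle (x : Fin 2) : ℝ :=
  if x = 0 then Real.pi / 6 else 2 * Real.pi / 3

/-- The spectral projection `(1 + a A) / 2` of the reference observable `A` of setting `x` for its
eigenvalue `a`. -/
noncomputable def ghzMeas (x : Fin 2) (a : ℤˣ) : Matrix (Fin 2) (Fin 2) ℂ :=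
  (1 / 2 : ℂ) • (1 + ((a : ℤ) : ℂ) • equatorial (ghzAngle x))

theorem equatorial_conjTranspose (θ : ℝ) : (equatorial θ).conjTranspose = equatorial θ := by
  ext i j
  fin_cases i <;> fin_cases j <;>
    simp [equatorial, Matrix.conjTranspose_apply, ← Complex.exp_conj]

theorem equatorial_mul_self (θ : ℝ) : equatorial θ * equatorial θ = 1 := by
  ext i j
  fin_cases i <;> fin_cases j <;>
    simp [equatorial, Matrix.mul_apply, Fin.sum_univ_two, ← Complex.exp_add]

theorem ghzMeas_isMeasurement (x : Fin 2) : IsMeasurement (ghzMeas x) where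
  posSemidef a := by
    have hH : (ghzMeas x a).conjTranspose = ghzMeas x a := by
      simp [ghzMeas, Matrix.conjTranspose_smul, Matrix.conjTranspose_add,
        equatorial_conjTranspose]
    have hP : ghzMeas x a * ghzMeas x a = ghzMeas x a := by
      have ha : (((a : ℤ) : ℂ)) * ((a : ℤ) : ℂ) = 1 := by
        rcases Int.units_eq_one_or a with h | h <;> simp [h]
      have hA : (((a : ℤ) : ℂ) • equatorial (ghzAngle x)) *
          (((a : ℤ) : ℂ) • equatorial (ghzAngle x)) = 1 := by
        rw [smul_mul_smul_comm, equatorial_mul_self, ha, one_smul]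
      simp only [ghzMeas]
      generalize ((a : ℤ) : ℂ) • equatorial (ghzAngle x) = A at hA
      rw [smul_mul_smul_comm, add_mul, mul_add, mul_add, hA, one_mul, mul_one, one_mul]
      module
    have h := Matrix.posSemidef_conjTranspose_mul_self (ghzMeas x a)
    rwa [hH, hP] at h
  sum_eq_one := by
    simp only [ghzMeas, Units.val_one, Units.val_neg, Int.cast_one, Int.cast_neg]
    module

theorem ghzState_norm : ∑ q, ‖ghzState q‖ ^ 2 = 1 := by
  simp [Fintype.sum_prod_type, Fin.sum_univ_two, ghzState]
  norm_num

/-- The reference realization: the GHZ state with the observables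
`A⁰ = equatorial (π/6)` and `A¹ = equatorial (2π/3)` for each party. -/
noncomputable def ghzRealization : Realization 2 2 2 where
  state := ghzState
  meas₁ := ghzMeas
  meas₂ := ghzMeas
  meas₃ := ghzMeas
  norm_state := ghzState_norm
  isMeasurement₁ := ghzMeas_isMeasurement
  isMeasurement₂ := ghzMeas_isMeasurement
  isMeasurement₃ := ghzMeas_isMeasurement

end HardyGHZ

/-! ### The scalar optimization. -/

namespace HardyGHZ

section

/-! Replace each effect of outcome `+1` by its support projection, `P i` for setting 0 and `Q i` for
setting 1. The Hardy constraints survive, because an effect and its support projection are left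
multiples of each other, and the success probability can only grow. So it suffices to bound `‖e‖²`
for `e = P 0 P 1 P 2 ψ`.

For each party, `Z = 1 - P - Q + PQ + QP` commutes with `P` and `Q` (this is Jordan's lemma for two
projections without the block decomposition). The three symmetric operators `Z` commute, so `ψ`
splits orthogonally into joint eigenvectors, each again satisfying the constraints. On such a block
with `Z i = 1 - s i`, all inner products between `ψ`, `nearEvent` and `coEvent` are determined by
`‖ψ‖²`, `‖e‖²` and the numbers `p i = 1 / s i`. With `S = p 0 + p 1 + p 2 - 2` and `t = p 0 * p 1 *
p 2`, nonnegativity of the squared distance from `ψ` to the span of these two vectors gives `‖ψ‖² ≥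
‖e‖² * S * t / (t - S)`. By AM-GM the factor is at least 8, with equality only when every `p i = 2`
(`hardy_scalar_bound`, `event_le_of_eigen`, `event_le`).

Equality forces `Z i ψ = ψ / 2`, that is, `2 P i - 1` and `2 Q i - 1` anticommute on `ψ`, and it
forces the distance to vanish, so `ψ = 2 nearEvent - 8 coEvent`. Flipping the failing branch of each
party with `2 Q i - 1` then sends every branch of `ψ` to `± e` (`branch_state`). Recording the
branch in a qubit is the local isometry; the signs assemble to GHZ in a suitable eigenbasis
(`ghzState_eq_sum`), and `e` becomes the junk state. Saturation also makes each original effect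
agree with its support projection on `ψ` (`eq_zero_of_commute`, `eq_zero_of_constraints`), which
transfers the measurements. -/

theorem hardy_scalar_bound {p q r : ℝ} (hp : 1 ≤ p) (hq : 1 ≤ q) (hr : 1 ≤ r) :
    8 * (p * q * r - (p + q + r - 2)) ≤ (p + q + r - 2) * (p * q * r) ∧
    (8 * (p * q * r - (p + q + r - 2)) = (p + q + r - 2) * (p * q * r) →
      p = 2 ∧ q = 2 ∧ r = 2) := by
  obtain ⟨S, hS⟩ : ∃ S, S = p + q + r - 2 := ⟨_, rfl⟩
  obtain ⟨t, ht⟩ : ∃ t, t = p * q * r := ⟨_, rfl⟩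
  have hS1 : 1 ≤ S := by linarith
  have ht1 : 0 < t := by rw [ht]; positivity
  -- AM-GM for `p`, `q`, `r` with an explicit remainder, so that the equality case can be read off.
  have hid : (S + 2) ^ 3 - 27 * t = (S + 2) / 2 * ((p - q) ^ 2 + (q - r) ^ 2 + (r - p) ^ 2)
      + 3 * (p * (q - r) ^ 2 + q * (r - p) ^ 2 + r * (p - q) ^ 2) := by
    rw [hS, ht]; ring
  have hnn1 : 0 ≤ 3 * (p * (q - r) ^ 2 + q * (r - p) ^ 2 + r * (p - q) ^ 2) := by positivity
  have hnn2 : 0 ≤ (S + 2) / 2 * ((p - q) ^ 2 + (q - r) ^ 2 + (r - p) ^ 2) := by positivity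
  rw [← hS, ← ht]
  -- The claim is `t * (8 - S) ≤ 8 * S`. Inserting `27 * t ≤ (S + 2) ^ 3` leaves a polynomial with a
  -- double root at the optimum `S = 4`; the other factor is positive for `S ≥ 1`.
  have hpoly : (S + 2) ^ 3 * (8 - S) - 216 * S = -((S - 4) ^ 2 * (S ^ 2 + 6 * S - 4)) := by ring
  rcases le_or_gt 8 S with h8 | h8
  · have h1 := mul_nonneg ht1.le (sub_nonneg.2 h8)
    exact ⟨by linarith, fun h => by linarith⟩
  · have h1 : 27 * t * (8 - S) ≤ (S + 2) ^ 3 * (8 - S) :=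
      mul_le_mul_of_nonneg_right (by linarith) (by linarith)
    have h2 : 0 ≤ (S - 4) ^ 2 * (S ^ 2 + 6 * S - 4) :=
      mul_nonneg (sq_nonneg _) (by nlinarith)
    refine ⟨by linarith, fun h => ?_⟩
    have h3 : (S - 4) ^ 2 * (S ^ 2 + 6 * S - 4) = 0 := by linarith
    have hS4 : S = 4 := by
      rcases mul_eq_zero.mp h3 with h | h
      · linarith [pow_eq_zero_iff (two_ne_zero) |>.mp h]
      · nlinarith
    subst hS4
    have ht8 : t = 8 := by linarith
    rw [ht8] at hid
    have h5 : (p - q) ^ 2 = 0 := by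
      linarith [sq_nonneg (p - q), sq_nonneg (q - r), sq_nonneg (r - p)]
    have h6 : (q - r) ^ 2 = 0 := by
      linarith [sq_nonneg (p - q), sq_nonneg (q - r), sq_nonneg (r - p)]
    rw [pow_eq_zero_iff two_ne_zero] at h5 h6
    refine ⟨by linarith, by linarith, by linarith⟩

/-- The form in `h` is the squared distance from `ψ` to `α • nearEvent + β • coEvent`, with `n = ‖ψ‖
^ 2` and `x = ‖event‖ ^ 2`. Its minimum is `n - S * t * x / (t - S)`. -/
theorem le_of_forall_quadratic_nonneg {n x S t : ℝ} (hx : 0 < x) (hS : 0 < S) (ht : 0 < t)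
    (hSt : S ≤ t) (h8 : 8 * (t - S) ≤ S * t)
    (h : ∀ α β : ℝ, 0 ≤ n + α ^ 2 * (S * x) + β ^ 2 * (x / t) - 2 * α * (S * x)
      + 2 * α * β * (S * x / t)) :
    8 * x ≤ n ∧ (8 * x = n → 8 * (t - S) = S * t) := by
  rcases hSt.eq_or_lt with rfl | hlt
  · exfalso
    -- For `S = t` the form is degenerate: along `β = -α * S` it is `n - 2 * α * S * x`, and this
    -- `α` makes it `-1`.
    have := h ((n + 1) / (2 * (S * x))) (-((n + 1) / (2 * (S * x))) * S)
    field_simp at this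
    nlinarith
  · have hd : 0 < t - S := by linarith
    -- The critical point: the `β`-derivative gives `β = -α * S`, then the `α`-derivative gives `α =
    -- t / (t - S)`.
    have h1 := h (t / (t - S)) (-(t / (t - S)) * S)
    have h2 : n + (t / (t - S)) ^ 2 * (S * x) + (-(t / (t - S)) * S) ^ 2 * (x / t)
        - 2 * (t / (t - S)) * (S * x) + 2 * (t / (t - S)) * (-(t / (t - S)) * S) * (S * x / t)
        = n - S * t * x / (t - S) := by
      field_simp; ring
    rw [h2, sub_nonneg, div_le_iff₀ hd] at h1
    have h3 : 8 * (t - S) * x ≤ S * t * x := mul_le_mul_of_nonneg_right h8 hx.le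
    refine ⟨le_of_mul_le_mul_right (by linarith) hd, fun he => le_antisymm h8 ?_⟩
    refine le_of_mul_le_mul_right ?_ hx
    rw [← he] at h1; linarith

end

end HardyGHZ

/-! ### Commuting projections and the bound in a joint eigenspace. -/

namespace HardyGHZ

section

variable {H : Type*} [NormedAddCommGroup H] [InnerProductSpace ℂ H]

/-- Two commuting-party families of projections: for each of the three parties `i` the orthogonal
projections `P i` and `Q i` commute with those of the other parties, and the vector `ψ` satisfies
Hardy's zero constraints. -/
structure IsHardyVector (P Q : Fin 3 → H →ₗ[ℂ] H) (ψ : H) : Prop where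
  symmP : ∀ i, (P i).IsSymmetric
  symmQ : ∀ i, (Q i).IsSymmetric
  idemP : ∀ i v, P i (P i v) = P i v
  idemQ : ∀ i v, Q i (Q i v) = Q i v
  commPP : ∀ i j, i ≠ j → ∀ v, P i (P j v) = P j (P i v)
  commPQ : ∀ i j, i ≠ j → ∀ v, P i (Q j v) = Q j (P i v)
  commQQ : ∀ i j, i ≠ j → ∀ v, Q i (Q j v) = Q j (Q i v)
  zero_one : ∀ i, Q i (P (i + 1) (P (i + 2) ψ)) = 0
  zero_all : (1 - Q 0 : H →ₗ[ℂ] H) ((1 - Q 1 : H →ₗ[ℂ] H) ((1 - Q 2 : H →ₗ[ℂ] H) ψ)) = 0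

/-- The element `1 - P - Q + PQ + QP`, central in the algebra generated by two projections. -/
def jordanOp (P Q : H →ₗ[ℂ] H) : H →ₗ[ℂ] H := 1 - P - Q + P * Q + Q * P

theorem jordanOp_apply (P Q : H →ₗ[ℂ] H) (v : H) :
    jordanOp P Q v = v - P v - Q v + P (Q v) + Q (P v) := rfl

open scoped InnerProductSpace

/-- `P (1 - Q) P = P (1 - Z)` for the central element `Z`. -/
theorem proj_compl_proj {P Q : H →ₗ[ℂ] H} (hP : ∀ v, P (P v) = P v) {v : H} {z : ℂ}
    (hv : P v = v) (hz : jordanOp P Q v = z • v) : P (v - Q v) = (1 - z) • v := by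
  have h := congrArg P hz
  simp only [jordanOp_apply, map_sub, map_add, map_smul, hP, hv] at h
  rw [map_sub, hv, sub_smul, one_smul, ← h]
  abel

/-- On the kernel of `Q` one has `(1 - Q) P = 1 - Z` for the central element `Z`. -/
theorem compl_proj_of_ker {P Q : H →ₗ[ℂ] H} {v : H} {z : ℂ}
    (hv : Q v = 0) (hz : jordanOp P Q v = z • v) : P v - Q (P v) = (1 - z) • v := by
  rw [jordanOp_apply, hv, map_zero] at hz
  rw [sub_smul, one_smul, ← hz]
  abel

namespace IsHardyVector

variable {P Q : Fin 3 → H →ₗ[ℂ] H} {ψ : H}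

/-- For the same party both sides are `P Q P`; different parties commute. -/
theorem jordanOp_comm_P (h : IsHardyVector P Q ψ) (i j : Fin 3) (v : H) :
    jordanOp (P i) (Q i) (P j v) = P j (jordanOp (P i) (Q i) v) := by
  rcases eq_or_ne i j with rfl | hij
  · simp only [jordanOp_apply, map_sub, map_add, h.idemP]; abel
  · simp only [jordanOp_apply, map_sub, map_add, h.commPP i j hij, ← h.commPQ j i hij.symm]

theorem jordanOp_comm_Q (h : IsHardyVector P Q ψ) (i j : Fin 3) (v : H) :
    jordanOp (P i) (Q i) (Q j v) = Q j (jordanOp (P i) (Q i) v) := by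
  rcases eq_or_ne i j with rfl | hij
  · simp only [jordanOp_apply, map_sub, map_add, h.idemQ]; abel
  · simp only [jordanOp_apply, map_sub, map_add, h.commPQ i j hij, h.commQQ i j hij]

theorem jordanOp_symm (h : IsHardyVector P Q ψ) (i : Fin 3) :
    (jordanOp (P i) (Q i)).IsSymmetric := by
  intro v w
  simp only [jordanOp_apply, inner_sub_left, inner_add_left, inner_sub_right, inner_add_right,
    h.symmP i _ _, h.symmQ i _ _]
  ring

/-- The unnormalized state `P j ⊗ P k ψ` conditioned on the two parties other than `i`. -/
def cond (P : Fin 3 → H →ₗ[ℂ] H) (ψ : H) (i : Fin 3) : H := P (i + 1) (P (i + 2) ψ)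

/-- The unnormalized Hardy event `P 0 ⊗ P 1 ⊗ P 2 ψ`. -/
def event (P : Fin 3 → H →ₗ[ℂ] H) (ψ : H) : H := P 0 (P 1 (P 2 ψ))

/-- The complementary projection `1 - Q i`. -/
def co (Q : Fin 3 → H →ₗ[ℂ] H) (i : Fin 3) : H →ₗ[ℂ] H := 1 - Q i

theorem co_apply (Q : Fin 3 → H →ₗ[ℂ] H) (i : Fin 3) (v : H) : co Q i v = v - Q i v := rfl

theorem symm_co (h : IsHardyVector P Q ψ) (i : Fin 3) : (co Q i).IsSymmetric := by
  intro v w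
  simp only [co_apply, inner_sub_left, inner_sub_right, h.symmQ i _ _]

theorem idem_co (h : IsHardyVector P Q ψ) (i : Fin 3) (v : H) : co Q i (co Q i v) = co Q i v := by
  simp only [co_apply, map_sub, h.idemQ]; abel

theorem comm_co_co (h : IsHardyVector P Q ψ) (i j : Fin 3) (hij : i ≠ j) (v : H) :
    co Q i (co Q j v) = co Q j (co Q i v) := by
  simp only [co_apply, map_sub, h.commQQ i j hij]; abel

theorem comm_proj_co (h : IsHardyVector P Q ψ) (i j : Fin 3) (hij : i ≠ j) (v : H) :
    P i (co Q j v) = co Q j (P i v) := by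
  simp only [co_apply, map_sub, h.commPQ i j hij]

theorem proj_cond_self (h : IsHardyVector P Q ψ) (i : Fin 3) : P i (cond P ψ i) = event P ψ := by
  have h01 := h.commPP 0 1 (by decide)
  have h02 := h.commPP 0 2 (by decide)
  have h12 := h.commPP 1 2 (by decide)
  fin_cases i
  · rfl
  · change P 1 (P 2 (P 0 ψ)) = P 0 (P 1 (P 2 ψ))
    rw [← h02, h01]
  · change P 2 (P 0 (P 1 ψ)) = P 0 (P 1 (P 2 ψ))
    rw [← h02, h12]

theorem proj_cond_of_ne (h : IsHardyVector P Q ψ) {i j : Fin 3} (hij : j ≠ i) :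
    P j (cond P ψ i) = cond P ψ i := by
  obtain rfl | rfl : j = i + 1 ∨ j = i + 2 := by revert i j; decide
  · exact h.idemP _ _
  · have : i + 1 ≠ i + 2 := by revert i; decide
    rw [cond, ← h.commPP _ _ this, h.idemP]

theorem proj_event (h : IsHardyVector P Q ψ) (i : Fin 3) : P i (event P ψ) = event P ψ := by
  rw [← h.proj_cond_self i, h.idemP]

theorem co_cond (h : IsHardyVector P Q ψ) (i : Fin 3) : co Q i (cond P ψ i) = cond P ψ i := by
  rw [co_apply, cond, h.zero_one, sub_zero]

theorem inner_event_cond (h : IsHardyVector P Q ψ) (i : Fin 3) :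
    ⟪event P ψ, cond P ψ i⟫_ℂ = ⟪event P ψ, event P ψ⟫_ℂ := by
  conv_lhs => rw [← h.proj_event i, h.symmP i _ _, h.proj_cond_self]

theorem inner_cond_event (h : IsHardyVector P Q ψ) (i : Fin 3) :
    ⟪cond P ψ i, event P ψ⟫_ℂ = ⟪event P ψ, event P ψ⟫_ℂ := by
  conv_lhs => rw [← h.proj_event i, ← h.symmP i _ _, h.proj_cond_self]

theorem inner_cond_cond (h : IsHardyVector P Q ψ) {i j : Fin 3} (hij : i ≠ j) :
    ⟪cond P ψ i, cond P ψ j⟫_ℂ = ⟪event P ψ, event P ψ⟫_ℂ := by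
  conv_lhs => rw [← h.proj_cond_of_ne hij, ← h.symmP i _ _, h.proj_cond_self]
  exact h.inner_event_cond j

theorem inner_state_cond (h : IsHardyVector P Q ψ) (i : Fin 3) :
    ⟪ψ, cond P ψ i⟫_ℂ = ⟪cond P ψ i, cond P ψ i⟫_ℂ := by
  have h1 : i + 1 ≠ i := by clear * -; revert i; decide
  have h2 : i + 2 ≠ i := by revert i; decide
  conv_rhs => rw [cond, h.symmP _ _ _, h.symmP _ _ _, ← cond, h.proj_cond_of_ne h1,
    h.proj_cond_of_ne h2]

theorem inner_state_event (h : IsHardyVector P Q ψ) :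
    ⟪ψ, event P ψ⟫_ℂ = ⟪event P ψ, event P ψ⟫_ℂ := by
  conv_rhs => rw [event, h.symmP _ _ _, h.symmP _ _ _, h.symmP _ _ _, ← event, h.proj_event,
    h.proj_event, h.proj_event]

/-- The image of the Hardy event under the three complementary projections. -/
def coEvent (P Q : Fin 3 → H →ₗ[ℂ] H) (ψ : H) : H := co Q 0 (co Q 1 (co Q 2 (event P ψ)))

theorem coEvent_eq (h : IsHardyVector P Q ψ) (i : Fin 3) :
    coEvent P Q ψ = co Q i (co Q (i + 1) (co Q (i + 2) (event P ψ))) := by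
  have h01 := h.comm_co_co 0 1 (by decide)
  have h02 := h.comm_co_co 0 2 (by decide)
  have h12 := h.comm_co_co 1 2 (by decide)
  fin_cases i
  · rfl
  · change _ = co Q 1 (co Q 2 (co Q 0 _))
    rw [← h02, ← h01]; rfl
  · change _ = co Q 2 (co Q 0 (co Q 1 _))
    rw [← h02, ← h12]; rfl

/-- The constraint on three failures enters here: moving the complementary projections onto `ψ`
annihilates it. -/
theorem inner_state_coEvent (h : IsHardyVector P Q ψ) : ⟪ψ, coEvent P Q ψ⟫_ℂ = 0 := by
  have h0 : co Q 0 (co Q 1 (co Q 2 ψ)) = 0 := h.zero_all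
  have h01 := h.comm_co_co 0 1 (by decide)
  have h02 := h.comm_co_co 0 2 (by decide)
  have h12 := h.comm_co_co 1 2 (by decide)
  rw [coEvent, ← h.symm_co 0 _ _, ← h.symm_co 1 _ _, ← h.symm_co 2 _ _, ← h01, ← h02, ← h12, h0,
    inner_zero_left]

section Block

variable {s : Fin 3 → ℝ}

theorem jordanOp_cond (h : IsHardyVector P Q ψ) (i j : Fin 3) {z : ℂ}
    (hz : jordanOp (P i) (Q i) ψ = z • ψ) :
    jordanOp (P i) (Q i) (cond P ψ j) = z • cond P ψ j := by
  rw [cond, h.jordanOp_comm_P, h.jordanOp_comm_P, hz, map_smul, map_smul]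

/-- The constraint on party `i` puts `cond i` in the kernel of `Q i`, where `(1 - Q) P` is the
scalar `z`; and `event` is `P i` of `cond i`. -/
theorem co_event (h : IsHardyVector P Q ψ) (i : Fin 3) {z : ℂ}
    (hz : jordanOp (P i) (Q i) ψ = (1 - z) • ψ) :
    co Q i (event P ψ) = z • cond P ψ i := by
  have := compl_proj_of_ker (h.zero_one i) (h.jordanOp_cond i i hz)
  rw [co_apply, ← h.proj_cond_self i]
  rw [sub_sub_cancel] at this
  exact this

/-- This fixes the eigenvalue by the ratio of the weights of `event` and `cond i`, leaving three
free real parameters per block. -/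
theorem mul_inner_cond_self (h : IsHardyVector P Q ψ) (i : Fin 3) {z : ℂ}
    (hz : jordanOp (P i) (Q i) ψ = (1 - z) • ψ) :
    z * ⟪cond P ψ i, cond P ψ i⟫_ℂ = ⟪event P ψ, event P ψ⟫_ℂ := by
  rw [← inner_smul_right, ← h.co_event i hz, ← h.symm_co i _ _, h.co_cond, h.inner_cond_event]

theorem inner_cond_co_cond (h : IsHardyVector P Q ψ) {i j k : Fin 3} (hij : j ≠ i) (hjk : j ≠ k)
    (hik : i ≠ k) {z : ℂ} (hz : jordanOp (P j) (Q j) ψ = (1 - z) • ψ) :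
    ⟪cond P ψ i, co Q j (cond P ψ k)⟫_ℂ = z * ⟪event P ψ, event P ψ⟫_ℂ := by
  have h1 := proj_compl_proj (h.idemP j) (h.proj_cond_of_ne hjk) (h.jordanOp_cond j k hz)
  rw [← h.proj_cond_of_ne hij, h.symmP j _ _, co_apply, h1, inner_smul_right, sub_sub_cancel,
    h.inner_cond_cond hik]

theorem inner_cond_coEvent (h : IsHardyVector P Q ψ) (i : Fin 3) {z w : ℂ}
    (hz : jordanOp (P (i + 1)) (Q (i + 1)) ψ = (1 - z) • ψ)
    (hw : jordanOp (P (i + 2)) (Q (i + 2)) ψ = (1 - w) • ψ) :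
    ⟪cond P ψ i, coEvent P Q ψ⟫_ℂ = z * w * ⟪event P ψ, event P ψ⟫_ℂ := by
  have h1 : i + 1 ≠ i := by clear * -; revert i; decide
  have h2 : i + 1 ≠ i + 2 := by clear * -; revert i; decide
  have h3 : i ≠ i + 2 := by clear * -; revert i; decide
  rw [h.coEvent_eq i, ← h.symm_co i _ _, h.co_cond, h.co_event _ hw, map_smul, inner_smul_right,
    h.inner_cond_co_cond h1 h2 h3 hz]
  ring

theorem inner_event_coEvent (h : IsHardyVector P Q ψ)
    (hz : ∀ i, jordanOp (P i) (Q i) ψ = (1 - (s i : ℂ)) • ψ) :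
    ⟪event P ψ, coEvent P Q ψ⟫_ℂ = s 0 * s 1 * s 2 * ⟪event P ψ, event P ψ⟫_ℂ := by
  rw [h.coEvent_eq 0, ← h.idem_co, ← h.coEvent_eq 0, ← h.symm_co 0 _ _, h.co_event 0 (hz 0),
    inner_smul_left, h.inner_cond_coEvent 0 (hz 1) (hz 2), Complex.conj_ofReal]
  ring

theorem inner_coEvent_coEvent (h : IsHardyVector P Q ψ)
    (hz : ∀ i, jordanOp (P i) (Q i) ψ = (1 - (s i : ℂ)) • ψ) :
    ⟪coEvent P Q ψ, coEvent P Q ψ⟫_ℂ = s 0 * s 1 * s 2 * ⟪event P ψ, event P ψ⟫_ℂ := by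
  rw [← h.inner_event_coEvent hz]
  have h2 := (h.coEvent_eq 2).symm
  conv_lhs => lhs; rw [coEvent]
  have key (i : Fin 3) : co Q i (coEvent P Q ψ) = coEvent P Q ψ := by
    rw [h.coEvent_eq i, h.idem_co]
  rw [h.symm_co 0 _ _, key, h.symm_co 1 _ _, key, h.symm_co 2 _ _, key]

/-- The combination `∑ i, cond i - 2 event`: the part of `ψ` in which at most one party fails. -/
def nearEvent (P : Fin 3 → H →ₗ[ℂ] H) (ψ : H) : H :=
  cond P ψ 0 + cond P ψ 1 + cond P ψ 2 - (2 : ℂ) • event P ψ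

/-- The Gram matrix of `ψ`, `nearEvent` and `coEvent`: `nearEvent` is as if it were an orthogonal
projection of `ψ`, since `⟪nearEvent, nearEvent⟫ = ⟪ψ, nearEvent⟫`, and `coEvent` is orthogonal to
`ψ` but not to `nearEvent`. The last fact gives the gain. -/
theorem norm_sq_combination (h : IsHardyVector P Q ψ)
    (hz : ∀ i, jordanOp (P i) (Q i) ψ = (1 - (s i : ℂ)) • ψ) (α β : ℝ) :
    ‖ψ - (α : ℂ) • nearEvent P ψ - (β : ℂ) • coEvent P Q ψ‖ ^ 2 =
      ‖ψ‖ ^ 2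
      + (α ^ 2 - 2 * α) * (‖cond P ψ 0‖ ^ 2 + ‖cond P ψ 1‖ ^ 2 + ‖cond P ψ 2‖ ^ 2
          - 2 * ‖event P ψ‖ ^ 2)
      + β ^ 2 * (s 0 * s 1 * s 2 * ‖event P ψ‖ ^ 2)
      + 2 * α * β * ((s 0 * s 1 + s 1 * s 2 + s 2 * s 0 - 2 * (s 0 * s 1 * s 2))
          * ‖event P ψ‖ ^ 2) := by
  have hN : ⟪nearEvent P ψ, coEvent P Q ψ⟫_ℂ =
      ((s 0 * s 1 + s 1 * s 2 + s 2 * s 0 - 2 * (s 0 * s 1 * s 2) : ℝ) : ℂ)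
        * ⟪event P ψ, event P ψ⟫_ℂ := by
    have h1 := h.inner_cond_coEvent 1 (hz 2) (hz 0)
    have h2 := h.inner_cond_coEvent 2 (hz 0) (hz 1)
    rw [nearEvent, inner_sub_left, inner_add_left, inner_add_left, inner_smul_left,
      h.inner_cond_coEvent 0 (hz 1) (hz 2), h1, h2, h.inner_event_coEvent hz]
    simp [map_ofNat]
    ring
  have hψ : ⟪ψ, nearEvent P ψ⟫_ℂ = ⟪cond P ψ 0, cond P ψ 0⟫_ℂ + ⟪cond P ψ 1, cond P ψ 1⟫_ℂ
      + ⟪cond P ψ 2, cond P ψ 2⟫_ℂ - 2 * ⟪event P ψ, event P ψ⟫_ℂ := by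
    simp only [nearEvent, inner_sub_right, inner_add_right, inner_smul_right, h.inner_state_cond,
      h.inner_state_event]
  have hu : ⟪nearEvent P ψ, nearEvent P ψ⟫_ℂ = ⟪ψ, nearEvent P ψ⟫_ℂ := by
    rw [hψ]
    simp only [nearEvent, inner_sub_right, inner_add_right, inner_smul_right, inner_sub_left,
      inner_add_left, inner_smul_left, h.inner_cond_event, h.inner_event_cond,
      h.inner_cond_cond (show (0 : Fin 3) ≠ 1 by decide),
      h.inner_cond_cond (show (0 : Fin 3) ≠ 2 by decide),
      h.inner_cond_cond (show (1 : Fin 3) ≠ 2 by decide),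
      h.inner_cond_cond (show (1 : Fin 3) ≠ 0 by decide),
      h.inner_cond_cond (show (2 : Fin 3) ≠ 0 by decide),
      h.inner_cond_cond (show (2 : Fin 3) ≠ 1 by decide)]
    simp [map_ofNat]
    ring
  have hψN := h.inner_state_coEvent
  have hψN' : ⟪coEvent P Q ψ, ψ⟫_ℂ = 0 := by rw [← inner_conj_symm, hψN, map_zero]
  have hre (v w : H) : (⟪v, w⟫_ℂ).re = (⟪w, v⟫_ℂ).re := inner_re_symm (𝕜 := ℂ) v w
  have hNN := congrArg Complex.re (h.inner_coEvent_coEvent hz)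
  have hN' := congrArg Complex.re hN
  have hψ' := congrArg Complex.re hψ
  have hu' := congrArg Complex.re hu
  have h2re (c : ℂ) : (2 * c).re = 2 * c.re := by simp
  have hns (v : H) : ‖v‖ ^ 2 = (⟪v, v⟫_ℂ).re := norm_sq_eq_re_inner (𝕜 := ℂ) v
  simp only [← Complex.ofReal_mul, Complex.re_ofReal_mul, Complex.add_re, Complex.sub_re,
    h2re] at hNN hN' hψ' hu'
  simp only [hns]
  simp only [inner_sub_left, inner_sub_right, inner_smul_left, inner_smul_right,
    Complex.sub_re, Complex.re_ofReal_mul, Complex.conj_ofReal, hψN, hψN', hu', hψ', hNN, hN',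
    hre _ ψ, hre (coEvent P Q ψ) (nearEvent P ψ), Complex.zero_re]
  ring

/-- In a joint eigenspace of the three central elements the Hardy event has at most one eighth of
the weight, and exactly that only if all three pairs of observables anticommute. -/
theorem event_le_of_eigen (h : IsHardyVector P Q ψ) {z : Fin 3 → ℂ}
    (hz : ∀ i, jordanOp (P i) (Q i) ψ = z i • ψ) :
    8 * ‖event P ψ‖ ^ 2 ≤ ‖ψ‖ ^ 2 ∧
    (8 * ‖event P ψ‖ ^ 2 = ‖ψ‖ ^ 2 → ∀ i, jordanOp (P i) (Q i) ψ = (1 / 2 : ℂ) • ψ) := by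
  rcases eq_or_ne (event P ψ) 0 with h0 | h0
  · rw [h0]
    simp only [norm_zero]
    refine ⟨by simp, fun he i => ?_⟩
    have : ψ = 0 := by
      rw [← norm_eq_zero, ← pow_eq_zero_iff two_ne_zero, ← he]; norm_num
    simp [this]
  have hx : 0 < ‖event P ψ‖ ^ 2 := pow_pos (norm_pos_iff.mpr h0) 2
  set x := ‖event P ψ‖ ^ 2 with hxdef
  have hc (v : H) : ⟪v, v⟫_ℂ = ((‖v‖ ^ 2 : ℝ) : ℂ) := by
    rw [inner_self_eq_norm_sq_to_K]; norm_cast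
  have hle (i : Fin 3) : x ≤ ‖cond P ψ i‖ ^ 2 := by
    have h1 : x = (⟪cond P ψ i, event P ψ⟫_ℂ).re := by
      rw [h.inner_cond_event, hc, Complex.ofReal_re]
    have h2 : (⟪cond P ψ i, event P ψ⟫_ℂ).re ≤ ‖cond P ψ i‖ * ‖event P ψ‖ :=
      re_inner_le_norm (𝕜 := ℂ) _ _
    have h3 : 0 < ‖event P ψ‖ := norm_pos_iff.mpr h0
    have h4 : ‖event P ψ‖ ≤ ‖cond P ψ i‖ := by
      rw [← h1, hxdef, sq] at h2
      exact le_of_mul_le_mul_right h2 h3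
    rw [hxdef]; gcongr
  -- `p i` is the inverse of the conditional probability that party `i` also succeeds.
  obtain ⟨p, hp⟩ : ∃ p : Fin 3 → ℝ, ∀ i, p i = ‖cond P ψ i‖ ^ 2 / x := ⟨_, fun _ => rfl⟩
  have hp1 (i : Fin 3) : 1 ≤ p i := by rw [hp, le_div_iff₀ hx, one_mul]; exact hle i
  have hpne (i : Fin 3) : p i ≠ 0 := by linarith [hp1 i]
  have hy (i : Fin 3) : ‖cond P ψ i‖ ^ 2 = p i * x := by rw [hp]; field_simp
  have hzp (i : Fin 3) : z i = 1 - (((p i)⁻¹ : ℝ) : ℂ) := by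
    have h1 := h.mul_inner_cond_self i (z := 1 - z i) (by rw [hz, sub_sub_cancel])
    rw [hc, hc, hy, ← hxdef, Complex.ofReal_mul, ← mul_assoc] at h1
    have h2 : (x : ℂ) ≠ 0 := by exact_mod_cast hx.ne'
    have h3 : (p i : ℂ) ≠ 0 := by exact_mod_cast hpne i
    have h4 : (1 - z i) * p i = 1 := mul_right_cancel₀ h2 (by rw [h1, one_mul])
    have h5 : 1 - z i = (p i : ℂ)⁻¹ := eq_inv_of_mul_eq_one_left h4
    rw [Complex.ofReal_inv, ← h5, sub_sub_cancel]
  have hform := h.norm_sq_combination (s := fun i => (p i)⁻¹)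
    (fun i => by rw [hz i, hzp i])
  obtain ⟨b1, b2⟩ := hardy_scalar_bound (hp1 0) (hp1 1) (hp1 2)
  have ht : 0 < p 0 * p 1 * p 2 := by
    have := hp1 0; have := hp1 1; have := hp1 2; positivity
  have hS : p 0 + p 1 + p 2 - 2 ≤ p 0 * p 1 * p 2 := by
    -- The difference of the two sides is `(p 0 - 1) * (p 1 - 1) + (p 2 - 1) * (p 0 * p 1 - 1)`.
    nlinarith [mul_nonneg (sub_nonneg.2 (hp1 0)) (sub_nonneg.2 (hp1 1)),
      mul_nonneg (sub_nonneg.2 (hp1 2)) (sub_nonneg.2 (one_le_mul_of_one_le_of_one_le (hp1 0) (hp1 1)))]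
  obtain ⟨c1, c2⟩ := le_of_forall_quadratic_nonneg (n := ‖ψ‖ ^ 2) hx
    (by linarith [hp1 0, hp1 1, hp1 2]) ht hS b1 (fun α β => by
      refine (sq_nonneg _).trans_eq ((hform α β).trans ?_)
      rw [hy, hy, hy, ← hxdef]
      have := hpne 0; have := hpne 1; have := hpne 2
      field_simp
      ring)
  refine ⟨c1, fun he => ?_⟩
  obtain ⟨e0, e1, e2⟩ := b2 (c2 he)
  have e (i : Fin 3) : p i = 2 := by fin_cases i <;> assumption
  intro i
  rw [hz, hzp, e]
  norm_num

end Block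

end IsHardyVector
end

end HardyGHZ

/-! ### From eigenspaces to arbitrary states, and the structure of optimal vectors. -/

namespace HardyGHZ

section

variable {H : Type*} [NormedAddCommGroup H] [InnerProductSpace ℂ H]

open scoped InnerProductSpace

open Module.End in
/-- Decomposition of a vector along the joint eigenspaces of commuting symmetric operators, which
is orthogonal and preserved by all operators commuting with them. -/
theorem exists_joint_eigen_decomposition [FiniteDimensional ℂ H] {ι : Type*} [Finite ι]
    {T : ι → H →ₗ[ℂ] H} (hT : ∀ i, (T i).IsSymmetric)
    (hC : ∀ i j v, T i (T j v) = T j (T i v)) (ψ : H) :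
    ∃ (s : Finset (ι → ℂ)) (φ : (ι → ℂ) → H), ψ = ∑ α ∈ s, φ α ∧
      (∀ α i, T i (φ α) = α i • φ α) ∧
      ∀ X : H →ₗ[ℂ] H, (∀ i v, T i (X v) = X (T i v)) → ‖X ψ‖ ^ 2 = ∑ α ∈ s, ‖X (φ α)‖ ^ 2 := by
  classical
  have hint := LinearMap.IsSymmetric.directSum_isInternal_of_pairwise_commute hT
    (fun i j _ => LinearMap.ext fun v => hC i j v)
  obtain ⟨l, hl⟩ := hint.surjective ψ
  rw [DirectSum.coeAddMonoidHom_eq_dfinsuppSum, DFinsupp.sum] at hl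
  have hmem (α : ι → ℂ) (i : ι) : T i (l α : H) = α i • (l α : H) :=
    mem_eigenspace_iff.mp ((Submodule.mem_iInf _).mp (l α).2 i)
  refine ⟨l.support, fun α => (l α : H), hl.symm, hmem, fun X hX => ?_⟩
  have hXmem (α : ι → ℂ) : X (l α : H) ∈ ⨅ j, eigenspace (T j) (α j) := by
    refine (Submodule.mem_iInf _).mpr fun i => mem_eigenspace_iff.mpr ?_
    rw [hX, hmem, map_smul]
  have := (LinearMap.IsSymmetric.orthogonalFamily_iInf_eigenspaces hT).norm_sum
    (fun α => ⟨X (l α : H), hXmem α⟩) l.support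
  rw [← hl, map_sum]
  exact this

namespace IsHardyVector

variable {P Q : Fin 3 → H →ₗ[ℂ] H} {ψ : H}

theorem jordanOp_comm (h : IsHardyVector P Q ψ) (i j : Fin 3) (v : H) :
    jordanOp (P i) (Q i) (jordanOp (P j) (Q j) v) =
      jordanOp (P j) (Q j) (jordanOp (P i) (Q i) v) := by
  rw [jordanOp_apply (P j), jordanOp_apply (P j)]
  simp only [map_sub, map_add, h.jordanOp_comm_P, h.jordanOp_comm_Q]

theorem jordanOp_comm_co (h : IsHardyVector P Q ψ) (i j : Fin 3) (v : H) :
    jordanOp (P i) (Q i) (co Q j v) = co Q j (jordanOp (P i) (Q i) v) := by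
  simp only [co_apply, map_sub, h.jordanOp_comm_Q]

/-- The Hardy event has at most one eighth of the weight, and exactly that only if all three pairs
of observables anticommute on the state. -/
theorem event_le [FiniteDimensional ℂ H] (h : IsHardyVector P Q ψ) :
    8 * ‖event P ψ‖ ^ 2 ≤ ‖ψ‖ ^ 2 ∧
    (8 * ‖event P ψ‖ ^ 2 = ‖ψ‖ ^ 2 → ∀ i, jordanOp (P i) (Q i) ψ = (1 / 2 : ℂ) • ψ) := by
  obtain ⟨s, φ, hs, hφ, hX⟩ := exists_joint_eigen_decomposition h.jordanOp_symm h.jordanOp_comm ψ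
  have hzero {X : H →ₗ[ℂ] H}
      (hc : ∀ i v, jordanOp (P i) (Q i) (X v) = X (jordanOp (P i) (Q i) v)) (h0 : X ψ = 0)
      (α : Fin 3 → ℂ) (hα : α ∈ s) : X (φ α) = 0 := by
    have h1 := hX X hc
    rw [h0, norm_zero, zero_pow two_ne_zero, eq_comm,
      Finset.sum_eq_zero_iff_of_nonneg (fun _ _ => sq_nonneg _)] at h1
    simpa using h1 α hα
  -- The operators in the constraints commute with every `jordanOp`, so they kill `ψ` only if they
  -- kill each of its components.
  have hφh (α : Fin 3 → ℂ) (hα : α ∈ s) : IsHardyVector P Q (φ α) :=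
    { h with
      zero_one := fun i => hzero (X := Q i ∘ₗ P (i + 1) ∘ₗ P (i + 2))
        (fun j v => by simp [h.jordanOp_comm_P, h.jordanOp_comm_Q]) (h.zero_one i) α hα
      zero_all := hzero (X := co Q 0 ∘ₗ co Q 1 ∘ₗ co Q 2)
        (fun j v => by simp [h.jordanOp_comm_co]) h.zero_all α hα }
  have hev : ‖event P ψ‖ ^ 2 = ∑ α ∈ s, ‖event P (φ α)‖ ^ 2 :=
    hX (P 0 ∘ₗ P 1 ∘ₗ P 2) (fun j v => by simp [h.jordanOp_comm_P])
  have hn : ‖ψ‖ ^ 2 = ∑ α ∈ s, ‖φ α‖ ^ 2 := hX LinearMap.id (fun j v => rfl)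
  have hle (α : Fin 3 → ℂ) (hα : α ∈ s) := ((hφh α hα).event_le_of_eigen (hφ α)).1
  rw [hev, hn, Finset.mul_sum]
  refine ⟨Finset.sum_le_sum hle, fun he i => ?_⟩
  rw [Finset.sum_eq_sum_iff_of_le hle] at he
  rw [hs, map_sum, Finset.smul_sum]
  exact Finset.sum_congr rfl fun α hα =>
    ((hφh α hα).event_le_of_eigen (hφ α)).2 (he α hα) i

/-- `branch P Q i 0` is `P i` and `branch P Q i 1` is `(2 Q i - 1) (1 - P i)`. -/
def branch (P Q : Fin 3 → H →ₗ[ℂ] H) (i : Fin 3) (a : Fin 2) : H →ₗ[ℂ] H :=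
  if a = 0 then P i else (2 * Q i - 1) * (1 - P i)

theorem branch_zero (i : Fin 3) (v : H) : branch P Q i 0 v = P i v := rfl

theorem branch_one (i : Fin 3) (v : H) :
    branch P Q i 1 v = (v - P i v) - (2 : ℂ) • co Q i (v - P i v) := by
  rw [co_apply]
  simp only [branch, one_ne_zero, if_false, Module.End.mul_apply, LinearMap.sub_apply,
    Module.End.one_apply, two_mul, LinearMap.add_apply]
  module

/-- The amplitudes of the optimal state in the branches. -/
def branchSign (a b c : Fin 2) : ℂ := if (a.val + b.val + c.val) % 3 = 0 then 1 else -1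

/-- A Hardy vector of maximal success probability. -/
structure IsOptimal (P Q : Fin 3 → H →ₗ[ℂ] H) (ψ : H) : Prop extends IsHardyVector P Q ψ where
  jordanOp_state : ∀ i, jordanOp (P i) (Q i) ψ = (1 / 2 : ℂ) • ψ
  state_eq : ψ = (2 : ℂ) • nearEvent P ψ - (8 : ℂ) • coEvent P Q ψ

theorem isOptimal [FiniteDimensional ℂ H] (h : IsHardyVector P Q ψ)
    (he : 8 * ‖event P ψ‖ ^ 2 = ‖ψ‖ ^ 2) : IsOptimal P Q ψ := by
  have hz := h.event_le.2 he
  refine { h with jordanOp_state := hz, state_eq := ?_ }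
  -- At the optimum every `p i = 2`, so `S = 4` and `t = 8`; the minimizer is `α = t / (t - S) = 2`,
  -- `β = -α * S = -8`, and the distance vanishes.
  have h1 := h.norm_sq_combination (s := fun _ => 1 / 2)
    (fun i => by rw [hz i]; norm_num) 2 (-8)
  have h2 : ‖ψ - ((2 : ℝ) : ℂ) • nearEvent P ψ - ((-8 : ℝ) : ℂ) • coEvent P Q ψ‖ ^ 2 = 0 := by
    rw [h1, ← he]; ring
  rw [pow_eq_zero_iff two_ne_zero, norm_eq_zero] at h2
  rw [← sub_eq_zero, ← h2]
  push_cast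
  module

theorem comm_branch_co (h : IsHardyVector P Q ψ) {i j : Fin 3} (hij : i ≠ j) (a : Fin 2) (v : H) :
    branch P Q i a (co Q j v) = co Q j (branch P Q i a v) := by
  fin_cases a
  · exact h.comm_proj_co i j hij v
  · simp only [Fin.mk_one, branch_one, map_sub, map_smul, h.comm_proj_co i j hij,
      h.comm_co_co i j hij]

theorem branch_event (h : IsHardyVector P Q ψ) (i : Fin 3) (a : Fin 2) :
    branch P Q i a (event P ψ) = (if a = 0 then 1 else 0 : ℂ) • event P ψ := by
  fin_cases a
  · simp [branch_zero, h.proj_event]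
  · simp [branch_one, h.proj_event]

theorem branch_cond_of_ne (h : IsHardyVector P Q ψ) {i j : Fin 3} (hij : i ≠ j) (a : Fin 2) :
    branch P Q i a (cond P ψ j) = (if a = 0 then 1 else 0 : ℂ) • cond P ψ j := by
  fin_cases a
  · simp [branch_zero, h.proj_cond_of_ne hij]
  · simp [branch_one, h.proj_cond_of_ne hij]

theorem nearEvent_eq (i : Fin 3) : nearEvent P ψ =
    cond P ψ i + cond P ψ (i + 1) + cond P ψ (i + 2) - (2 : ℂ) • event P ψ := by
  fin_cases i
  · rfl
  · change cond P ψ 0 + cond P ψ 1 + cond P ψ 2 - _ = cond P ψ 1 + cond P ψ 2 + cond P ψ 0 - _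
    abel
  · change cond P ψ 0 + cond P ψ 1 + cond P ψ 2 - _ = cond P ψ 2 + cond P ψ 0 + cond P ψ 1 - _
    abel

namespace IsOptimal

theorem co_event (h : IsOptimal P Q ψ) (i : Fin 3) :
    co Q i (event P ψ) = (1 / 2 : ℂ) • cond P ψ i :=
  h.toIsHardyVector.co_event i (by rw [h.jordanOp_state]; norm_num)

/-- The failing part `cond i - event` is reflected by `2 Q i - 1` to `-event`, since `1 - Q i` fixes
`cond i` and maps `event` to half of it. -/
theorem branch_cond_self (h : IsOptimal P Q ψ) (i : Fin 3) (a : Fin 2) :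
    branch P Q i a (cond P ψ i) = (if a = 0 then 1 else -1 : ℂ) • event P ψ := by
  fin_cases a
  · simp [branch_zero, h.proj_cond_self]
  · simp only [Fin.mk_one, branch_one, h.proj_cond_self, map_sub, h.co_cond, h.co_event]
    simp only [one_ne_zero, if_false]
    module

theorem branch_co_event (h : IsOptimal P Q ψ) (i : Fin 3) (a : Fin 2) :
    branch P Q i a (co Q i (event P ψ)) = ((if a = 0 then 1 else -1) / 2 : ℂ) • event P ψ := by
  rw [h.co_event, map_smul, h.branch_cond_self, smul_smul]
  ring_nf

/-- The heart of the self-test: all eight branches carry the same vector up to sign. Each branch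
operator acts by scalars on the terms of `state_eq`, reducing them all to multiples of `event`. -/
theorem branch_state (h : IsOptimal P Q ψ) (i : Fin 3) (a b c : Fin 2) :
    branch P Q i a (branch P Q (i + 1) b (branch P Q (i + 2) c ψ)) =
      branchSign a b c • event P ψ := by
  have h1 : i + 1 ≠ i := by clear * -; revert i; decide
  have h2 : i + 1 ≠ i + 2 := by clear * -; revert i; decide
  have h3 : i ≠ i + 2 := by clear * -; revert i; decide
  have h0 := h.toIsHardyVector
  have hN : branch P Q i a (branch P Q (i + 1) b (branch P Q (i + 2) c (coEvent P Q ψ))) =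
      ((if a = 0 then 1 else -1) / 2 * ((if b = 0 then 1 else -1) / 2)
        * ((if c = 0 then 1 else -1) / 2) : ℂ) • event P ψ := by
    rw [h0.coEvent_eq i, h0.comm_branch_co h3.symm, h0.comm_branch_co h2.symm, h.branch_co_event,
      h0.comm_branch_co h1, map_smul, map_smul, h.branch_co_event, map_smul, map_smul,
      map_smul, map_smul, h.branch_co_event, smul_smul, smul_smul]
    ring_nf
  conv_lhs => rw [h.state_eq, nearEvent_eq i]
  simp only [map_sub, map_add, map_smul, hN]
  rw [h.branch_cond_self, h0.branch_cond_of_ne h3.symm, h0.branch_cond_of_ne h2.symm,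
    h0.branch_event]
  simp only [map_smul]
  rw [h.branch_cond_self, h0.branch_cond_of_ne h1, h0.branch_event]
  simp only [map_smul]
  rw [h.branch_cond_self, h0.branch_event]
  simp only [smul_smul, ← add_smul, ← sub_smul]
  congr 1
  fin_cases a <;> fin_cases b <;> fin_cases c <;> simp [branchSign] <;> norm_num

/-- An operator of party `i` that kills the state conditioned on the other parties, before and
after applying `P i`, kills the state. -/
theorem eq_zero_of_commute (h : IsOptimal P Q ψ) (i : Fin 3) {T : H →ₗ[ℂ] H}
    (hTQ : ∀ j, j ≠ i → ∀ v, T (Q j v) = Q j (T v))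
    (h1 : T (cond P ψ i) = 0) (h2 : T (event P ψ) = 0) : T ψ = 0 := by
  have e1 : i + 1 ≠ i := by clear * -; revert i; decide
  have e2 : i + 2 ≠ i := by clear * -; revert i; decide
  -- The reflection `2 Q j - 1` is an involution, so `w` is recovered from its two branches by
  -- operators that `T` respects.
  have hrec (j : Fin 3) (hj : j ≠ i) (w : H) (hw : ∀ a, T (branch P Q j a w) = 0) : T w = 0 := by
    have hw0 := hw 0
    have hw1 := hw 1
    rw [branch_zero] at hw0
    have hco : branch P Q j 1 w - (2 : ℂ) • co Q j (branch P Q j 1 w) = w - P j w := by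
      rw [branch_one]
      simp only [map_sub, map_smul, h.idem_co]
      module
    have hTco (v : H) : T (co Q j v) = co Q j (T v) := by
      rw [co_apply, co_apply, map_sub, hTQ j hj]
    have := congrArg T hco
    rw [map_sub, map_smul, hTco, hw1, map_sub, hw0] at this
    simpa using this.symm
  refine hrec _ e2 ψ fun c => hrec _ e1 _ fun b => ?_
  set w := branch P Q (i + 1) b (branch P Q (i + 2) c ψ) with hw
  have hw0 : branch P Q i 0 w = _ := h.branch_state i 0 b c
  have hw1 : branch P Q i 1 w = _ := h.branch_state i 1 b c
  have hco : branch P Q i 1 w - (2 : ℂ) • co Q i (branch P Q i 1 w) = w - P i w := by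
    rw [branch_one]
    simp only [map_sub, map_smul, h.idem_co]
    module
  rw [branch_zero] at hw0
  rw [hw1, hw0, map_smul, h.co_event] at hco
  have := congrArg T hco
  simpa [h1, h2] using this.symm

/-- If `F ≤ Q i` is an effect of party `i` for which the Hardy constraints hold, it agrees with
`Q i` on the state; here `T = Q i - F`. -/
theorem eq_zero_of_constraints (h : IsOptimal P Q ψ) (i : Fin 3) {T : H →ₗ[ℂ] H}
    (hTP : ∀ j, j ≠ i → ∀ v, T (P j v) = P j (T v))
    (hTQ : ∀ j, j ≠ i → ∀ v, T (Q j v) = Q j (T v))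
    (h1 : T (cond P ψ i) = 0) (h2 : T (co Q (i + 1) (co Q (i + 2) ψ)) = 0) : T ψ = 0 := by
  refine h.eq_zero_of_commute i hTQ h1 ?_
  have e1 : i + 1 ≠ i := by clear * -; revert i; decide
  have e2 : i + 2 ≠ i := by clear * -; revert i; decide
  have e3 : i + 1 ≠ i + 2 := by clear * -; revert i; decide
  have h0 := h.toIsHardyVector
  have hpc {j : Fin 3} {v : H} (hv : P j v = v) (hz : jordanOp (P j) (Q j) v = (1 / 2 : ℂ) • v) :
      P j (co Q j v) = (1 / 2 : ℂ) • v := by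
    rw [co_apply, proj_compl_proj (h.idemP j) hv hz]; norm_num
  have hpcc {j k : Fin 3} (hjk : j ≠ k) :
      P j (co Q j (cond P ψ k)) = (1 / 2 : ℂ) • cond P ψ k :=
    hpc (h.proj_cond_of_ne hjk) (h.jordanOp_cond j k (h.jordanOp_state j))
  have hpce (j : Fin 3) : P j (co Q j (event P ψ)) = (1 / 2 : ℂ) • event P ψ := by
    rw [h.co_event, map_smul, h.proj_cond_self]
  have hpcs (j : Fin 3) : P j (co Q j (cond P ψ j)) = event P ψ := by
    rw [h.co_cond, h.proj_cond_self]
  -- The vector killed through `h2` has a nonzero `event` component besides `cond i`, so `T` must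
  -- kill `event` too.
  have hstate : P (i + 1) (co Q (i + 1) (P (i + 2) (co Q (i + 2) ψ))) =
      event P ψ - (1 / 2 : ℂ) • cond P ψ i := by
    have hN : P (i + 1) (co Q (i + 1) (P (i + 2) (co Q (i + 2) (coEvent P Q ψ)))) =
        (1 / 8 : ℂ) • cond P ψ i := by
      rw [h0.coEvent_eq i, ← h.comm_co_co i (i + 2) e2.symm, ← h.comm_co_co _ _ e3, h.idem_co,
        h.comm_proj_co _ _ e2, h.comm_proj_co _ _ e3.symm, hpce, ← h.comm_co_co _ _ e1.symm,
        h.comm_proj_co _ _ e1, h.idem_co, map_smul, map_smul, hpce, map_smul, map_smul, h.co_event]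
      module
    conv_lhs => rw [h.state_eq, nearEvent_eq i]
    simp only [map_sub, map_add, map_smul, hN]
    rw [hpcc e2, hpcc e3.symm, hpcs, hpce]
    simp only [map_smul]
    rw [hpcc e1, hpcs, hpce]
    simp only [map_smul, hpce]
    module
  have h3 : T (P (i + 1) (co Q (i + 1) (P (i + 2) (co Q (i + 2) ψ)))) = 0 := by
    rw [← h.comm_proj_co _ _ e3.symm, hTP _ e1, hTP _ e2, h2, map_zero, map_zero]
  rw [hstate, map_sub, map_smul, h1, smul_zero, sub_zero] at h3
  exact h3

end IsOptimal

end IsHardyVector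
end

end HardyGHZ

/-! ### Support projections, and operators of a single party on the tensor product. -/

namespace HardyGHZ

section

open scoped Kronecker ComplexOrder InnerProductSpace

section Support

variable {n : Type*} [Fintype n]

/-- `P` is the support projection of the effect `E`. -/
structure IsSupport (E P : Matrix n n ℂ) : Prop where
  herm : P.IsHermitian
  idem : P * P = P
  exists_left : ∃ X, X * E = P
  proj_mul : P * E = E
  mul_proj : E * P = E
  posSemidef : P.PosSemidef
  posSemidef_effect : E.PosSemidef
  posSemidef_sub : (P - E).PosSemidef

theorem IsSupport.sub_mul_proj {E P : Matrix n n ℂ} (h : IsSupport E P) : (P - E) * P = P - E := by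
  rw [sub_mul, h.idem, h.mul_proj]

variable [DecidableEq n]

/-- The support projection of a Hermitian matrix `E`, together with a pseudoinverse `X`. -/
theorem exists_support_projection {E : Matrix n n ℂ} (hE : E.IsHermitian) :
    ∃ P X : Matrix n n ℂ, P.IsHermitian ∧ P * P = P ∧ X * E = P ∧ E * X = P ∧ P * E = E ∧
      E * P = E := by
  obtain ⟨φ, D, hD⟩ : ∃ (φ : Matrix n n ℂ ≃⋆ₐ[ℂ] Matrix n n ℂ) (D : n → ℝ),
      E = φ (Matrix.diagonal (fun i => (D i : ℂ))) :=
    ⟨_, _, hE.spectral_theorem⟩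
  have h0 (i : n) : (D i : ℂ)⁻¹ * D i * D i = D i := by
    rcases eq_or_ne (D i : ℂ) 0 with h | h
    · simp [h]
    · rw [inv_mul_cancel₀ h, one_mul]
  have h1 (i : n) : (D i : ℂ)⁻¹ * D i * ((D i : ℂ)⁻¹ * D i) = (D i : ℂ)⁻¹ * D i := by
    rw [mul_left_comm, h0, mul_comm]
  -- As `0⁻¹ = 0`, the entries `D⁻¹ * D` are the indicator of the nonzero eigenvalues.
  refine ⟨φ (Matrix.diagonal fun i => (D i : ℂ)⁻¹ * D i), φ (Matrix.diagonal fun i => (D i : ℂ)⁻¹),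
    ?_, ?_, ?_, ?_, ?_, ?_⟩
  · rw [Matrix.IsHermitian, ← Matrix.star_eq_conjTranspose, ← map_star,
      Matrix.star_eq_conjTranspose, Matrix.diagonal_conjTranspose]
    congr 2
    ext i
    simp
  · rw [← map_mul, Matrix.diagonal_mul_diagonal]
    simp only [h1]
  · rw [hD, ← map_mul, Matrix.diagonal_mul_diagonal]
  · rw [hD, ← map_mul, Matrix.diagonal_mul_diagonal]
    simp only [mul_comm]
  · rw [hD, ← map_mul, Matrix.diagonal_mul_diagonal]
    simp only [h0]
  · rw [hD, ← map_mul, Matrix.diagonal_mul_diagonal]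
    simp only [mul_comm _ ((_ : ℂ) * _), h0]

theorem exists_isSupport {M : ℤˣ → Matrix n n ℂ} (hM : IsMeasurement M) :
    ∃ P, IsSupport (M 1) P := by
  obtain ⟨P, X, h1, h2, h3, h4, h5, h6⟩ := exists_support_projection (hM.posSemidef 1).1
  refine ⟨P, h1, h2, ⟨X, h3⟩, h5, h6, ?_, hM.posSemidef 1, ?_⟩
  · have := Matrix.posSemidef_conjTranspose_mul_self P
    rwa [h1.eq, h2] at this
  -- `P - E` equals `P (1 - E) P`, a compression of the other effect.
  · have := (hM.posSemidef (-1)).conjTranspose_mul_mul_same P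
    rwa [eq_sub_of_add_eq' hM.sum_eq_one, h1.eq, mul_sub, mul_one, h5, sub_mul, h2, h6] at this

theorem IsSupport.co_mul_co {E P : Matrix n n ℂ} (h : IsSupport E P) :
    (1 - P) * (1 - E) = 1 - P := by
  rw [sub_mul, one_mul, mul_sub, mul_one, h.proj_mul]; abel

theorem IsSupport.proj_mul_co {E P : Matrix n n ℂ} (h : IsSupport E P) :
    P * (1 - E) = P - E := by
  rw [mul_sub, mul_one, h.proj_mul]

end Support

section Parties

variable {m n : Type*} [Fintype m] [DecidableEq m] [Fintype n] [DecidableEq n]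

/-- The algebra homomorphism `A ↦ A ⊗ 1`. -/
def kroneckerLeft (m n : Type*) [Fintype m] [DecidableEq m] [Fintype n] [DecidableEq n] :
    Matrix m m ℂ →ₐ[ℂ] Matrix (m × n) (m × n) ℂ :=
  AlgHom.ofLinearMap (Matrix.kroneckerBilinear (R := ℂ) (α := ℂ) |>.flip (1 : Matrix n n ℂ))
    Matrix.one_kronecker_one
    (fun A B => by
      change (A * B) ⊗ₖ (1 : Matrix n n ℂ) = (A ⊗ₖ 1) * (B ⊗ₖ 1)
      rw [← Matrix.mul_kronecker_mul, one_mul])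

/-- The algebra homomorphism `B ↦ 1 ⊗ B`. -/
def kroneckerRight (m n : Type*) [Fintype m] [DecidableEq m] [Fintype n] [DecidableEq n] :
    Matrix n n ℂ →ₐ[ℂ] Matrix (m × n) (m × n) ℂ :=
  AlgHom.ofLinearMap (Matrix.kroneckerBilinear (R := ℂ) (α := ℂ) (1 : Matrix m m ℂ))
    Matrix.one_kronecker_one
    (fun A B => by
      change (1 : Matrix m m ℂ) ⊗ₖ (A * B) = (1 ⊗ₖ A) * (1 ⊗ₖ B)
      rw [← Matrix.mul_kronecker_mul, one_mul])

variable {d₁ d₂ d₃ : ℕ}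

/-- The operators of the first party. -/
noncomputable def party₁ : Matrix (Fin d₁) (Fin d₁) ℂ →ₐ[ℂ]
    Module.End ℂ (EuclideanSpace ℂ (Fin d₁ × Fin d₂ × Fin d₃)) :=
  (Matrix.toLpLinAlgEquiv 2).toAlgHom.comp (kroneckerLeft (Fin d₁) (Fin d₂ × Fin d₃))

/-- The operators of the second party. -/
noncomputable def party₂ : Matrix (Fin d₂) (Fin d₂) ℂ →ₐ[ℂ]
    Module.End ℂ (EuclideanSpace ℂ (Fin d₁ × Fin d₂ × Fin d₃)) :=
  (Matrix.toLpLinAlgEquiv 2).toAlgHom.comp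
    ((kroneckerRight (Fin d₁) (Fin d₂ × Fin d₃)).comp (kroneckerLeft (Fin d₂) (Fin d₃)))

/-- The operators of the third party. -/
noncomputable def party₃ : Matrix (Fin d₃) (Fin d₃) ℂ →ₐ[ℂ]
    Module.End ℂ (EuclideanSpace ℂ (Fin d₁ × Fin d₂ × Fin d₃)) :=
  (Matrix.toLpLinAlgEquiv 2).toAlgHom.comp
    ((kroneckerRight (Fin d₁) (Fin d₂ × Fin d₃)).comp (kroneckerRight (Fin d₂) (Fin d₃)))

variable (ψ : Fin d₁ × Fin d₂ × Fin d₃ → ℂ)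

/-- The vector `A ⊗ B ⊗ C ψ` of the Hilbert space. -/
noncomputable def tensorVec (A : Matrix (Fin d₁) (Fin d₁) ℂ) (B : Matrix (Fin d₂) (Fin d₂) ℂ)
    (C : Matrix (Fin d₃) (Fin d₃) ℂ) : EuclideanSpace ℂ (Fin d₁ × Fin d₂ × Fin d₃) :=
  WithLp.toLp 2 ((A ⊗ₖ (B ⊗ₖ C)).mulVec ψ)

variable {A A' : Matrix (Fin d₁) (Fin d₁) ℂ} {B B' : Matrix (Fin d₂) (Fin d₂) ℂ}
  {C C' : Matrix (Fin d₃) (Fin d₃) ℂ}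

theorem party₁_tensorVec : party₁ A (tensorVec ψ A' B C) = tensorVec ψ (A * A') B C := by
  change WithLp.toLp 2 (((A ⊗ₖ (1 : Matrix (Fin d₂ × Fin d₃) (Fin d₂ × Fin d₃) ℂ))).mulVec
    ((A' ⊗ₖ (B ⊗ₖ C)).mulVec ψ)) = _
  rw [Matrix.mulVec_mulVec, ← Matrix.mul_kronecker_mul, one_mul, tensorVec]

theorem party₂_tensorVec : party₂ B (tensorVec ψ A B' C) = tensorVec ψ A (B * B') C := by
  change WithLp.toLp 2 (((1 : Matrix (Fin d₁) (Fin d₁) ℂ) ⊗ₖ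
    (B ⊗ₖ (1 : Matrix (Fin d₃) (Fin d₃) ℂ))).mulVec ((A ⊗ₖ (B' ⊗ₖ C)).mulVec ψ)) = _
  rw [Matrix.mulVec_mulVec, ← Matrix.mul_kronecker_mul, ← Matrix.mul_kronecker_mul, one_mul,
    one_mul, tensorVec]

theorem party₃_tensorVec : party₃ C (tensorVec ψ A B C') = tensorVec ψ A B (C * C') := by
  change WithLp.toLp 2 (((1 : Matrix (Fin d₁) (Fin d₁) ℂ) ⊗ₖ
    ((1 : Matrix (Fin d₂) (Fin d₂) ℂ) ⊗ₖ C)).mulVec ((A ⊗ₖ (B ⊗ₖ C')).mulVec ψ)) = _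
  rw [Matrix.mulVec_mulVec, ← Matrix.mul_kronecker_mul, ← Matrix.mul_kronecker_mul, one_mul,
    one_mul, tensorVec]

theorem tensorVec_one : tensorVec ψ 1 1 1 = WithLp.toLp 2 ψ := by
  rw [tensorVec, Matrix.one_kronecker_one, Matrix.one_kronecker_one, Matrix.one_mulVec]

theorem party₁_party₂_comm (A : Matrix (Fin d₁) (Fin d₁) ℂ) (B : Matrix (Fin d₂) (Fin d₂) ℂ)
    (v : EuclideanSpace ℂ (Fin d₁ × Fin d₂ × Fin d₃)) :
    party₁ A (party₂ B v) = party₂ B (party₁ A v) := by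
  obtain ⟨v, rfl⟩ : ∃ w, v = tensorVec w 1 1 1 := ⟨v.ofLp, (tensorVec_one _).symm⟩
  simp only [party₁_tensorVec, party₂_tensorVec]

theorem party₁_party₃_comm (A : Matrix (Fin d₁) (Fin d₁) ℂ) (C : Matrix (Fin d₃) (Fin d₃) ℂ)
    (v : EuclideanSpace ℂ (Fin d₁ × Fin d₂ × Fin d₃)) :
    party₁ A (party₃ C v) = party₃ C (party₁ A v) := by
  obtain ⟨v, rfl⟩ : ∃ w, v = tensorVec w 1 1 1 := ⟨v.ofLp, (tensorVec_one _).symm⟩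
  simp only [party₁_tensorVec, party₃_tensorVec]

theorem party₂_party₃_comm (B : Matrix (Fin d₂) (Fin d₂) ℂ) (C : Matrix (Fin d₃) (Fin d₃) ℂ)
    (v : EuclideanSpace ℂ (Fin d₁ × Fin d₂ × Fin d₃)) :
    party₂ B (party₃ C v) = party₃ C (party₂ B v) := by
  obtain ⟨v, rfl⟩ : ∃ w, v = tensorVec w 1 1 1 := ⟨v.ofLp, (tensorVec_one _).symm⟩
  simp only [party₂_tensorVec, party₃_tensorVec]

theorem party₁_symm (hA : A.IsHermitian) :
    (party₁ A : Module.End ℂ (EuclideanSpace ℂ (Fin d₁ × Fin d₂ × Fin d₃))).IsSymmetric := by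
  refine Matrix.isSymmetric_toEuclideanLin_iff.mpr ?_
  change (A ⊗ₖ (1 : Matrix (Fin d₂ × Fin d₃) (Fin d₂ × Fin d₃) ℂ)).IsHermitian
  rw [Matrix.IsHermitian, Matrix.conjTranspose_kronecker, hA.eq, Matrix.conjTranspose_one]

theorem party₂_symm (hB : B.IsHermitian) :
    (party₂ B : Module.End ℂ (EuclideanSpace ℂ (Fin d₁ × Fin d₂ × Fin d₃))).IsSymmetric := by
  refine Matrix.isSymmetric_toEuclideanLin_iff.mpr ?_
  change ((1 : Matrix (Fin d₁) (Fin d₁) ℂ) ⊗ₖ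
    (B ⊗ₖ (1 : Matrix (Fin d₃) (Fin d₃) ℂ))).IsHermitian
  rw [Matrix.IsHermitian, Matrix.conjTranspose_kronecker, Matrix.conjTranspose_kronecker, hB.eq,
    Matrix.conjTranspose_one, Matrix.conjTranspose_one]

theorem party₃_symm (hC : C.IsHermitian) :
    (party₃ C : Module.End ℂ (EuclideanSpace ℂ (Fin d₁ × Fin d₂ × Fin d₃))).IsSymmetric := by
  refine Matrix.isSymmetric_toEuclideanLin_iff.mpr ?_
  change ((1 : Matrix (Fin d₁) (Fin d₁) ℂ) ⊗ₖ
    ((1 : Matrix (Fin d₂) (Fin d₂) ℂ) ⊗ₖ C)).IsHermitian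
  rw [Matrix.IsHermitian, Matrix.conjTranspose_kronecker, Matrix.conjTranspose_kronecker, hC.eq,
    Matrix.conjTranspose_one, Matrix.conjTranspose_one]

theorem tensorVec_sub_left : tensorVec ψ (A - A') B C = tensorVec ψ A B C - tensorVec ψ A' B C := by
  have h := LinearMap.congr_fun (map_sub (party₁ (d₁ := d₁) (d₂ := d₂) (d₃ := d₃)) A A') (tensorVec ψ 1 B C)
  rwa [LinearMap.sub_apply, party₁_tensorVec, party₁_tensorVec, party₁_tensorVec, mul_one, mul_one,
    mul_one] at h

theorem tensorVec_sub_mid : tensorVec ψ A (B - B') C = tensorVec ψ A B C - tensorVec ψ A B' C := by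
  have h := LinearMap.congr_fun (map_sub (party₂ (d₁ := d₁) (d₂ := d₂) (d₃ := d₃)) B B') (tensorVec ψ A 1 C)
  rwa [LinearMap.sub_apply, party₂_tensorVec, party₂_tensorVec, party₂_tensorVec, mul_one, mul_one,
    mul_one] at h

theorem tensorVec_sub_right :
    tensorVec ψ A B (C - C') = tensorVec ψ A B C - tensorVec ψ A B C' := by
  have h := LinearMap.congr_fun (map_sub (party₃ (d₁ := d₁) (d₂ := d₂) (d₃ := d₃)) C C') (tensorVec ψ A B 1)
  rwa [LinearMap.sub_apply, party₃_tensorVec, party₃_tensorVec, party₃_tensorVec, mul_one, mul_one,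
    mul_one] at h

theorem tensorVec_eq_zero_mul (h : tensorVec ψ A B C = 0) (A' : Matrix (Fin d₁) (Fin d₁) ℂ)
    (B' : Matrix (Fin d₂) (Fin d₂) ℂ) (C' : Matrix (Fin d₃) (Fin d₃) ℂ) :
    tensorVec ψ (A' * A) (B' * B) (C' * C) = 0 := by
  rw [← party₁_tensorVec, ← party₂_tensorVec, ← party₃_tensorVec, h, map_zero, map_zero, map_zero]

/-- The expectation value `⟨ψ| A ⊗ B ⊗ C |ψ⟩`. -/
noncomputable def expect (A : Matrix (Fin d₁) (Fin d₁) ℂ) (B : Matrix (Fin d₂) (Fin d₂) ℂ)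
    (C : Matrix (Fin d₃) (Fin d₃) ℂ) : ℝ := (star ψ ⬝ᵥ (A ⊗ₖ (B ⊗ₖ C)).mulVec ψ).re

theorem expect_eq_inner :
    expect ψ A B C = (⟪(WithLp.toLp 2 ψ : EuclideanSpace ℂ _), tensorVec ψ A B C⟫_ℂ).re := by
  rw [expect, tensorVec, EuclideanSpace.inner_eq_star_dotProduct, dotProduct_comm]

theorem expect_nonneg (hA : A.PosSemidef) (hB : B.PosSemidef) (hC : C.PosSemidef) :
    0 ≤ expect ψ A B C :=
  (hA.kronecker (hB.kronecker hC)).re_dotProduct_nonneg ψ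

/-- A positive semidefinite operator with zero expectation annihilates the vector; this turns zero
probabilities into vector equations. -/
theorem tensorVec_eq_zero_of_expect (hA : A.PosSemidef) (hB : B.PosSemidef) (hC : C.PosSemidef)
    (h : expect ψ A B C = 0) : tensorVec ψ A B C = 0 := by
  have hpsd := hA.kronecker (hB.kronecker hC)
  have h0 : star ψ ⬝ᵥ (A ⊗ₖ (B ⊗ₖ C)).mulVec ψ = 0 := by
    have h1 := hpsd.dotProduct_mulVec_nonneg ψ
    apply Complex.ext h
    exact (Complex.le_def.mp h1).2.symm
  rw [tensorVec, (hpsd.dotProduct_mulVec_zero_iff ψ).mp h0]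
  rfl

theorem expect_sub_left : expect ψ (A - A') B C = expect ψ A B C - expect ψ A' B C := by
  simp only [expect_eq_inner, tensorVec_sub_left, inner_sub_right, Complex.sub_re]

theorem expect_sub_mid : expect ψ A (B - B') C = expect ψ A B C - expect ψ A B' C := by
  simp only [expect_eq_inner, tensorVec_sub_mid, inner_sub_right, Complex.sub_re]

theorem expect_sub_right : expect ψ A B (C - C') = expect ψ A B C - expect ψ A B C' := by
  simp only [expect_eq_inner, tensorVec_sub_right, inner_sub_right, Complex.sub_re]

end Parties
end

end HardyGHZ

/-! ### The reference qubit frame and the local isometry. -/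

namespace HardyGHZ

section

open scoped Kronecker ComplexOrder InnerProductSpace

section Frame

/-- The phase `e^{iπ/6}`. -/
noncomputable def ghzPhase : ℂ := Complex.exp (((Real.pi / 6 : ℝ) : ℂ) * Complex.I)

theorem ghzPhase_pow_three : ghzPhase ^ 3 = Complex.I := by
  rw [ghzPhase, ← Complex.exp_nat_mul]
  exact (congrArg Complex.exp (by push_cast; ring)).trans Complex.exp_pi_div_two_mul_I

theorem ghzPhase_ne_zero : ghzPhase ≠ 0 := Complex.exp_ne_zero _

theorem normSq_ghzPhase : (starRingEnd ℂ) ghzPhase * ghzPhase = 1 := by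
  rw [ghzPhase, ← Complex.exp_conj, ← Complex.exp_add, map_mul, Complex.conj_ofReal,
    Complex.conj_I, mul_neg, neg_add_cancel, Complex.exp_zero]

/-- `1 / √2` as a complex number. -/
noncomputable def invSqrtTwo : ℂ := ((1 / Real.sqrt 2 : ℝ) : ℂ)

theorem invSqrtTwo_mul_self : invSqrtTwo * invSqrtTwo = 1 / 2 := by
  rw [invSqrtTwo, ← Complex.ofReal_mul, div_mul_div_comm, Real.mul_self_sqrt (by norm_num)]
  norm_num

theorem conj_invSqrtTwo : (starRingEnd ℂ) invSqrtTwo = invSqrtTwo := Complex.conj_ofReal _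

/-- The eigenbasis of the reference observable of setting `0`, with the phases chosen such that
the reference observable of setting `1` exchanges the two vectors. -/
noncomputable def ghzFrame (s k : Fin 2) : ℂ :=
  !![invSqrtTwo, invSqrtTwo * ghzPhase;
    -Complex.I * invSqrtTwo, Complex.I * invSqrtTwo * ghzPhase] s k

theorem equatorial_zero : equatorial (ghzAngle 0) = !![0, ghzPhase⁻¹; ghzPhase, 0] := by
  rw [equatorial, ghzPhase, Complex.exp_neg]
  simp [ghzAngle]

/-- The angle `2π/3` is `π/6 + π/2`, so the phase is multiplied by `I`. -/
theorem equatorial_one : equatorial (ghzAngle 1) =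
    !![0, -Complex.I * ghzPhase⁻¹; Complex.I * ghzPhase, 0] := by
  have h : Complex.exp ((ghzAngle 1 : ℂ) * Complex.I) = Complex.I * ghzPhase := by
    refine Eq.trans (b := ghzPhase ^ 3 * ghzPhase) ?_ (congrArg (· * ghzPhase) ghzPhase_pow_three)
    rw [← pow_succ, ghzPhase, ← Complex.exp_nat_mul]
    simp only [ghzAngle, one_ne_zero, if_false]
    congr 1
    push_cast
    ring
  rw [equatorial, Complex.exp_neg, h, mul_inv, Complex.inv_I]

theorem ghzMeas_zero_mulVec_zero (k : Fin 2) :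
    ∑ k', ghzMeas 0 1 k k' * ghzFrame 0 k' = ghzFrame 0 k := by
  have := ghzPhase_ne_zero
  rw [ghzMeas, equatorial_zero]
  fin_cases k <;> simp [Fin.sum_univ_two, ghzFrame] <;> field_simp <;> ring

theorem ghzMeas_zero_mulVec_one (k : Fin 2) :
    ∑ k', ghzMeas 0 1 k k' * ghzFrame 1 k' = 0 := by
  have := ghzPhase_ne_zero
  rw [ghzMeas, equatorial_zero]
  fin_cases k <;> simp [Fin.sum_univ_two, ghzFrame] <;> field_simp <;> ring

theorem ghzMeas_one_mulVec (s k : Fin 2) :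
    ∑ k', ghzMeas 1 1 k k' * ghzFrame s k' = (1 / 2) * (ghzFrame 0 k + ghzFrame 1 k) := by
  have := ghzPhase_ne_zero
  rw [ghzMeas, equatorial_one]
  fin_cases s <;> fin_cases k <;> simp [Fin.sum_univ_two, ghzFrame] <;> field_simp <;>
    try ring_nf
  all_goals
    rw [Complex.I_sq]
    ring

theorem ghzFrame_orthonormal (s t : Fin 2) :
    ∑ k, (starRingEnd ℂ) (ghzFrame s k) * ghzFrame t k = if s = t then 1 else 0 := by
  have h1 := invSqrtTwo_mul_self
  have h2 := normSq_ghzPhase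
  have h3 := conj_invSqrtTwo
  have hI := Complex.I_mul_I
  fin_cases s <;> fin_cases t <;> simp [Fin.sum_univ_two, ghzFrame, h3]
  · linear_combination (1 + (starRingEnd ℂ) ghzPhase * ghzPhase) * h1 + (1 / 2) * h2
  · linear_combination Complex.I * invSqrtTwo * invSqrtTwo * h2
  · linear_combination -Complex.I * invSqrtTwo * invSqrtTwo * h2
  · linear_combination (1 + (starRingEnd ℂ) ghzPhase * ghzPhase) * h1 + (1 / 2) * h2 - (1 + (starRingEnd ℂ) ghzPhase * ghzPhase) * invSqrtTwo * invSqrtTwo * hI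

/-- The branch signs are the coefficients of GHZ in the frame, up to the scalar `2 * (1 + I)`. For
instance the `000` entry is `1 - 3 (-I) - 3 (-I)² + (-I)³ = 4 (1 + I)` times `invSqrtTwo ^ 3`. -/
theorem ghzState_eq_sum (k₁ k₂ k₃ : Fin 2) :
    ∑ a, ∑ b, ∑ c, ghzFrame a k₁ * ghzFrame b k₂ * ghzFrame c k₃ *
      IsHardyVector.branchSign a b c = ghzState (k₁, k₂, k₃) * (2 * (1 + Complex.I)) := by
  have h1 := invSqrtTwo_mul_self
  have h2 := ghzPhase_pow_three
  have hI := Complex.I_mul_I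
  have h3 : ghzState (k₁, k₂, k₃) = if (k₁, k₂, k₃) = (0, 0, 0) ∨ (k₁, k₂, k₃) = (1, 1, 1)
    then invSqrtTwo else 0 := rfl
  rw [h3]
  fin_cases k₁ <;> fin_cases k₂ <;> fin_cases k₃ <;>
    simp [Fin.sum_univ_two, ghzFrame, IsHardyVector.branchSign]
  · linear_combination -(invSqrtTwo ^ 3 * (3 + Complex.I)) * hI
      + 4 * invSqrtTwo * (1 + Complex.I) * h1
  · linear_combination invSqrtTwo ^ 3 * ghzPhase * (1 + Complex.I) * hI
  · linear_combination invSqrtTwo ^ 3 * ghzPhase * (1 + Complex.I) * hI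
  · linear_combination invSqrtTwo ^ 3 * ghzPhase ^ 2 * (1 - Complex.I) * hI
  · linear_combination invSqrtTwo ^ 3 * ghzPhase * (1 + Complex.I) * hI
  · linear_combination invSqrtTwo ^ 3 * ghzPhase ^ 2 * (1 - Complex.I) * hI
  · linear_combination invSqrtTwo ^ 3 * ghzPhase ^ 2 * (1 - Complex.I) * hI
  · linear_combination invSqrtTwo ^ 3 * (Complex.I ^ 2 - 3 * Complex.I - 4) * hI
      + 4 * invSqrtTwo * (1 + Complex.I) * h1
      + invSqrtTwo ^ 3 * (1 - 3 * Complex.I - 3 * Complex.I ^ 2 + Complex.I ^ 3) * h2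

end Frame

section Intertwiner

variable {n : Type*} [Fintype n] [DecidableEq n]

/-- The matrix analogue of `IsHardyVector.branch`. -/
def branchMatrix (p q : Matrix n n ℂ) (s : Fin 2) : Matrix n n ℂ :=
  if s = 0 then p else ((2 : ℂ) • q - 1) * (1 - p)

/-- The `k`-th block of rows of the local isometry. -/
noncomputable def isometryBlock (p q : Matrix n n ℂ) (k : Fin 2) : Matrix n n ℂ :=
  ∑ s, ghzFrame s k • branchMatrix p q s

/-- The local isometry extracting a qubit. -/
noncomputable def localIsometry (p q : Matrix n n ℂ) : Matrix (n × Fin 2) n ℂ :=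
  Matrix.of fun jk i => isometryBlock p q jk.2 jk.1 i

theorem branchMatrix_gram {p q : Matrix n n ℂ} (hp : p.IsHermitian) (hpp : p * p = p)
    (hq : q.IsHermitian) (hqq : q * q = q) :
    (branchMatrix p q 0).conjTranspose * branchMatrix p q 0
      + (branchMatrix p q 1).conjTranspose * branchMatrix p q 1 = 1 := by
  have hB : ((2 : ℂ) • q - 1) * ((2 : ℂ) • q - 1) = 1 := by
    simp only [sub_mul, mul_sub, smul_mul_assoc, mul_smul_comm, hqq, one_mul, mul_one]
    module
  have hBH : ((2 : ℂ) • q - 1).conjTranspose = (2 : ℂ) • q - 1 := by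
    simp [Matrix.conjTranspose_smul, hq.eq]
  have h0 : branchMatrix p q 0 = p := rfl
  have h1 : branchMatrix p q 1 = ((2 : ℂ) • q - 1) * (1 - p) := rfl
  rw [h0, h1, Matrix.conjTranspose_mul, hBH, hp.eq, hpp, mul_assoc, ← mul_assoc _ _ (1 - p), hB,
    one_mul, Matrix.conjTranspose_sub, Matrix.conjTranspose_one, hp.eq]
  simp only [sub_mul, mul_sub, one_mul, mul_one, hpp]
  abel

/-- The branch label is stored in an orthonormal frame, so cross terms vanish and the Gram matrices
of the branches add up to `p + (1 - p)`. -/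
theorem localIsometry_isometry {p q : Matrix n n ℂ} (hp : p.IsHermitian) (hpp : p * p = p)
    (hq : q.IsHermitian) (hqq : q * q = q) :
    (localIsometry p q).conjTranspose * localIsometry p q = 1 := by
  have h1 : (localIsometry p q).conjTranspose * localIsometry p q =
      ∑ k, (isometryBlock p q k).conjTranspose * isometryBlock p q k := by
    ext i j
    rw [Matrix.sum_apply, Matrix.mul_apply, Fintype.sum_prod_type, Finset.sum_comm]
    rfl
  have h2 : ∑ k, (isometryBlock p q k).conjTranspose * isometryBlock p q k =
      ∑ s, ∑ t, (∑ k, (starRingEnd ℂ) (ghzFrame s k) * ghzFrame t k) •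
        ((branchMatrix p q s).conjTranspose * branchMatrix p q t) := by
    simp only [isometryBlock, Fin.sum_univ_two, Matrix.conjTranspose_add,
      Matrix.conjTranspose_smul, add_mul, mul_add, smul_mul_assoc, mul_smul_comm,
      ← starRingEnd_apply]
    module
  rw [h1, h2]
  simp only [ghzFrame_orthonormal]
  simpa [Fin.sum_univ_two] using branchMatrix_gram hp hpp hq hqq

variable {H : Type*} [AddCommGroup H] [Module ℂ H]

/-- On the vector `v`, the measurement `M` of a party acts by the projections `p`, `q`, whose
observables anticommute. -/
structure IsMatched (L : Matrix n n ℂ →ₐ[ℂ] Module.End ℂ H) (v : H)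
    (M : Fin 2 → ℤˣ → Matrix n n ℂ) (p q : Matrix n n ℂ) : Prop where
  proj_zero : L (p - M 0 1) v = 0
  proj_one : L (q - M 1 1) v = 0
  anticomm : L (1 - p - q + p * q + q * p - (1 / 2 : ℂ) • 1) v = 0

/-- On `v`, measuring before the isometry agrees with the reference measurement on the extracted
qubit. Only one party is involved, which lets the three be treated independently. -/
theorem IsMatched.intertwine {L : Matrix n n ℂ →ₐ[ℂ] Module.End ℂ H} {v : H}
    {M : Fin 2 → ℤˣ → Matrix n n ℂ} {p q : Matrix n n ℂ} (h : IsMatched L v M p q)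
    (hM : ∀ x, IsMeasurement (M x)) (hpp : p * p = p) (hqq : q * q = q)
    (x : Fin 2) (a : ℤˣ) (k : Fin 2) :
    L (isometryBlock p q k * M x a - ∑ k', ghzMeas x a k k' • isometryBlock p q k') v = 0 := by
  have hsum (x : Fin 2) : ∑ k', ghzMeas x 1 k k' • isometryBlock p q k' =
      (∑ k', ghzMeas x 1 k k' * ghzFrame 0 k') • branchMatrix p q 0 +
      (∑ k', ghzMeas x 1 k k' * ghzFrame 1 k') • branchMatrix p q 1 := by
    simp only [isometryBlock, Fin.sum_univ_two]
    module
  have h0 : branchMatrix p q 0 = p := rfl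
  have h1 : branchMatrix p q 1 = ((2 : ℂ) • q - 1) * (1 - p) := rfl
  have hblock : isometryBlock p q k =
      ghzFrame 0 k • branchMatrix p q 0 + ghzFrame 1 k • branchMatrix p q 1 := by
    rw [isometryBlock, Fin.sum_univ_two]
  have hone : L (isometryBlock p q k * M x 1
      - ∑ k', ghzMeas x 1 k k' • isometryBlock p q k') v = 0 := by
    obtain rfl | rfl : x = 0 ∨ x = 1 := by revert x; decide
    · have hK : isometryBlock p q k * p = ghzFrame 0 k • p := by
        rw [hblock, h0, h1, add_mul, smul_mul_assoc, smul_mul_assoc, mul_assoc, sub_mul 1 p p,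
          hpp, one_mul, sub_self, mul_zero, smul_zero, add_zero]
      have e : isometryBlock p q k * M 0 1 - ∑ k', ghzMeas 0 1 k k' • isometryBlock p q k' =
          - (isometryBlock p q k * (p - M 0 1)) := by
        rw [hsum, ghzMeas_zero_mulVec_zero, ghzMeas_zero_mulVec_one, mul_sub, hK, h0]
        module
      rw [e, map_neg, map_mul, LinearMap.neg_apply, Module.End.mul_apply, h.proj_zero, map_zero,
        neg_zero]
    · have hqq' (y : Matrix n n ℂ) : q * (q * y) = q * y := by rw [← mul_assoc, hqq]
      -- The intertwining relation for `q` holds up to a left multiple of the anticommutation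
      -- defect, which kills `v`. The coefficient `1 / 2 * (ghzFrame 0 k + ghzFrame 1 k)` reflects
      -- that the reference observable swaps the frame vectors.
      have hK : isometryBlock p q k * q =
          (ghzFrame 0 k • 1 + ghzFrame 1 k • (1 - (2 : ℂ) • q)) *
            (1 - p - q + p * q + q * p - (1 / 2 : ℂ) • 1) +
          (1 / 2 * (ghzFrame 0 k + ghzFrame 1 k)) • (branchMatrix p q 0 + branchMatrix p q 1) := by
        rw [hblock, h0, h1]
        simp only [add_mul, mul_add, sub_mul, mul_sub, smul_mul_assoc, mul_smul_comm, mul_assoc,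
          hqq, hqq', one_mul, mul_one]
        module
      have e : isometryBlock p q k * M 1 1 - ∑ k', ghzMeas 1 1 k k' • isometryBlock p q k' =
          (ghzFrame 0 k • 1 + ghzFrame 1 k • (1 - (2 : ℂ) • q)) *
            (1 - p - q + p * q + q * p - (1 / 2 : ℂ) • 1)
          - (isometryBlock p q k * (q - M 1 1)) := by
        rw [hsum, ghzMeas_one_mulVec, ghzMeas_one_mulVec, mul_sub (isometryBlock p q k), hK]
        module
      rw [e, map_sub, map_mul, map_mul, LinearMap.sub_apply, Module.End.mul_apply,
        Module.End.mul_apply, h.proj_one, h.anticomm, map_zero, map_zero, sub_zero]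
  rcases Int.units_eq_one_or a with rfl | rfl
  · exact hone
  · have e : isometryBlock p q k * M x (-1) - ∑ k', ghzMeas x (-1) k k' • isometryBlock p q k' =
        - (isometryBlock p q k * M x 1 - ∑ k', ghzMeas x 1 k k' • isometryBlock p q k') := by
      rw [eq_sub_of_add_eq' (hM x).sum_eq_one,
        eq_sub_of_add_eq' (ghzMeas_isMeasurement x).sum_eq_one]
      simp only [Matrix.sub_apply, sub_smul, Finset.sum_sub_distrib, Matrix.one_apply, ite_smul,
        one_smul, zero_smul, Finset.sum_ite_eq, Finset.mem_univ, if_true, mul_sub, mul_one]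
      abel
    rw [e, map_neg, LinearMap.neg_apply, hone, neg_zero]

end Intertwiner
end

end HardyGHZ

/-! ### Reducing a realization to its support projections. -/

namespace HardyGHZ

section

open scoped Kronecker ComplexOrder InnerProductSpace

variable {d₁ d₂ d₃ : ℕ}

theorem map_apply_idem {n H : Type*} [Fintype n] [DecidableEq n] [AddCommGroup H] [Module ℂ H]
    {L : Matrix n n ℂ →ₐ[ℂ] Module.End ℂ H} {p : Matrix n n ℂ} (hp : p * p = p) (v : H) :
    L p (L p v) = L p v := by
  rw [← Module.End.mul_apply, ← map_mul, hp]

/-- Support projections of the effects with outcome `+1` of a realization. -/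
structure Realization.Supports (R : Realization d₁ d₂ d₃) where
  p₁ : Matrix (Fin d₁) (Fin d₁) ℂ
  q₁ : Matrix (Fin d₁) (Fin d₁) ℂ
  p₂ : Matrix (Fin d₂) (Fin d₂) ℂ
  q₂ : Matrix (Fin d₂) (Fin d₂) ℂ
  p₃ : Matrix (Fin d₃) (Fin d₃) ℂ
  q₃ : Matrix (Fin d₃) (Fin d₃) ℂ
  hp₁ : IsSupport (R.meas₁ 0 1) p₁
  hq₁ : IsSupport (R.meas₁ 1 1) q₁
  hp₂ : IsSupport (R.meas₂ 0 1) p₂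
  hq₂ : IsSupport (R.meas₂ 1 1) q₂
  hp₃ : IsSupport (R.meas₃ 0 1) p₃
  hq₃ : IsSupport (R.meas₃ 1 1) q₃

theorem Realization.nonempty_supports (R : Realization d₁ d₂ d₃) : Nonempty R.Supports := by
  obtain ⟨p₁, hp₁⟩ := exists_isSupport (R.isMeasurement₁ 0)
  obtain ⟨q₁, hq₁⟩ := exists_isSupport (R.isMeasurement₁ 1)
  obtain ⟨p₂, hp₂⟩ := exists_isSupport (R.isMeasurement₂ 0)
  obtain ⟨q₂, hq₂⟩ := exists_isSupport (R.isMeasurement₂ 1)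
  obtain ⟨p₃, hp₃⟩ := exists_isSupport (R.isMeasurement₃ 0)
  obtain ⟨q₃, hq₃⟩ := exists_isSupport (R.isMeasurement₃ 1)
  exact ⟨⟨p₁, q₁, p₂, q₂, p₃, q₃, hp₁, hq₁, hp₂, hq₂, hp₃, hq₃⟩⟩

namespace Realization.Supports

variable {R : Realization d₁ d₂ d₃}

/-- The support projections of setting `0` on the joint Hilbert space. -/
noncomputable def P (S : R.Supports) :
    Fin 3 → Module.End ℂ (EuclideanSpace ℂ (Fin d₁ × Fin d₂ × Fin d₃)) :=
  ![party₁ S.p₁, party₂ S.p₂, party₃ S.p₃]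

/-- The support projections of setting `1` on the joint Hilbert space. -/
noncomputable def Q (S : R.Supports) :
    Fin 3 → Module.End ℂ (EuclideanSpace ℂ (Fin d₁ × Fin d₂ × Fin d₃)) :=
  ![party₁ S.q₁, party₂ S.q₂, party₃ S.q₃]

theorem co_Q_zero (S : R.Supports) : IsHardyVector.co S.Q 0 = party₁ (1 - S.q₁) := by
  rw [map_sub, map_one]; rfl

theorem co_Q_one (S : R.Supports) : IsHardyVector.co S.Q 1 = party₂ (1 - S.q₂) := by
  rw [map_sub, map_one]; rfl

theorem co_Q_two (S : R.Supports) : IsHardyVector.co S.Q 2 = party₃ (1 - S.q₃) := by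
  rw [map_sub, map_one]; rfl

/-- The state as a vector of the joint Hilbert space. -/
noncomputable def vec (_ : R.Supports) : EuclideanSpace ℂ (Fin d₁ × Fin d₂ × Fin d₃) :=
  WithLp.toLp 2 R.state

theorem vec_eq (S : R.Supports) : S.vec = tensorVec R.state 1 1 1 := (tensorVec_one _).symm

theorem norm_vec (S : R.Supports) : ‖S.vec‖ ^ 2 = 1 := by
  rw [EuclideanSpace.norm_sq_eq]
  exact R.norm_state

theorem event_eq (S : R.Supports) :
    IsHardyVector.event S.P S.vec = tensorVec R.state S.p₁ S.p₂ S.p₃ := by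
  change party₁ S.p₁ (party₂ S.p₂ (party₃ S.p₃ S.vec)) = _
  rw [vec_eq, party₃_tensorVec, party₂_tensorVec, party₁_tensorVec, mul_one, mul_one, mul_one]

/-- Left multiples are allowed for `q` so that this serves both the support projection and the
effect itself. -/
theorem tensorVec_zero₁ (S : R.Supports) (h : R.SatisfiesHardy) {q : Matrix (Fin d₁) (Fin d₁) ℂ}
    (hq : ∃ X, X * R.meas₁ 1 1 = q) : tensorVec R.state q S.p₂ S.p₃ = 0 := by
  have h0 := tensorVec_eq_zero_of_expect R.state S.hq₁.posSemidef_effect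
    S.hp₂.posSemidef_effect S.hp₃.posSemidef_effect h.zero₁
  obtain ⟨X, rfl⟩ := hq
  obtain ⟨Y, hY⟩ := S.hp₂.exists_left
  obtain ⟨Z, hZ⟩ := S.hp₃.exists_left
  rw [← hY, ← hZ]
  exact tensorVec_eq_zero_mul _ h0 X Y Z

theorem tensorVec_zero₂ (S : R.Supports) (h : R.SatisfiesHardy) {q : Matrix (Fin d₂) (Fin d₂) ℂ}
    (hq : ∃ X, X * R.meas₂ 1 1 = q) : tensorVec R.state S.p₁ q S.p₃ = 0 := by
  have h0 := tensorVec_eq_zero_of_expect R.state S.hp₁.posSemidef_effect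
    S.hq₂.posSemidef_effect S.hp₃.posSemidef_effect h.zero₂
  obtain ⟨X, rfl⟩ := hq
  obtain ⟨Y, hY⟩ := S.hp₁.exists_left
  obtain ⟨Z, hZ⟩ := S.hp₃.exists_left
  rw [← hY, ← hZ]
  exact tensorVec_eq_zero_mul _ h0 Y X Z

theorem tensorVec_zero₃ (S : R.Supports) (h : R.SatisfiesHardy) {q : Matrix (Fin d₃) (Fin d₃) ℂ}
    (hq : ∃ X, X * R.meas₃ 1 1 = q) : tensorVec R.state S.p₁ S.p₂ q = 0 := by
  have h0 := tensorVec_eq_zero_of_expect R.state S.hp₁.posSemidef_effect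
    S.hp₂.posSemidef_effect S.hq₃.posSemidef_effect h.zero₃
  obtain ⟨X, rfl⟩ := hq
  obtain ⟨Y, hY⟩ := S.hp₁.exists_left
  obtain ⟨Z, hZ⟩ := S.hp₂.exists_left
  rw [← hY, ← hZ]
  exact tensorVec_eq_zero_mul _ h0 Y Z X

theorem tensorVec_co_eq_zero (_ : R.Supports) (h : R.SatisfiesHardy)
    (A : Matrix (Fin d₁) (Fin d₁) ℂ) (B : Matrix (Fin d₂) (Fin d₂) ℂ)
    (C : Matrix (Fin d₃) (Fin d₃) ℂ) :
    tensorVec R.state (A * (1 - R.meas₁ 1 1)) (B * (1 - R.meas₂ 1 1)) (C * (1 - R.meas₃ 1 1))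
      = 0 := by
  rw [← eq_sub_of_add_eq' (R.isMeasurement₁ 1).sum_eq_one,
    ← eq_sub_of_add_eq' (R.isMeasurement₂ 1).sum_eq_one,
    ← eq_sub_of_add_eq' (R.isMeasurement₃ 1).sum_eq_one]
  exact tensorVec_eq_zero_mul _ (tensorVec_eq_zero_of_expect R.state
    ((R.isMeasurement₁ 1).posSemidef _) ((R.isMeasurement₂ 1).posSemidef _)
    ((R.isMeasurement₃ 1).posSemidef _) h.zero₄) A B C

theorem isHardyVector (S : R.Supports) (h : R.SatisfiesHardy) :
    IsHardyVector S.P S.Q S.vec where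
  symmP i := by
    fin_cases i
    exacts [party₁_symm S.hp₁.herm, party₂_symm S.hp₂.herm, party₃_symm S.hp₃.herm]
  symmQ i := by
    fin_cases i
    exacts [party₁_symm S.hq₁.herm, party₂_symm S.hq₂.herm, party₃_symm S.hq₃.herm]
  idemP i v := by
    fin_cases i
    exacts [map_apply_idem S.hp₁.idem v, map_apply_idem S.hp₂.idem v, map_apply_idem S.hp₃.idem v]
  idemQ i v := by
    fin_cases i
    exacts [map_apply_idem S.hq₁.idem v, map_apply_idem S.hq₂.idem v, map_apply_idem S.hq₃.idem v]
  commPP i j hij v := by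
    fin_cases i <;> fin_cases j
    exacts [absurd rfl hij, party₁_party₂_comm _ _ v, party₁_party₃_comm _ _ v,
      (party₁_party₂_comm _ _ v).symm, absurd rfl hij, party₂_party₃_comm _ _ v,
      (party₁_party₃_comm _ _ v).symm, (party₂_party₃_comm _ _ v).symm, absurd rfl hij]
  commPQ i j hij v := by
    fin_cases i <;> fin_cases j
    exacts [absurd rfl hij, party₁_party₂_comm _ _ v, party₁_party₃_comm _ _ v,
      (party₁_party₂_comm _ _ v).symm, absurd rfl hij, party₂_party₃_comm _ _ v,
      (party₁_party₃_comm _ _ v).symm, (party₂_party₃_comm _ _ v).symm, absurd rfl hij]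
  commQQ i j hij v := by
    fin_cases i <;> fin_cases j
    exacts [absurd rfl hij, party₁_party₂_comm _ _ v, party₁_party₃_comm _ _ v,
      (party₁_party₂_comm _ _ v).symm, absurd rfl hij, party₂_party₃_comm _ _ v,
      (party₁_party₃_comm _ _ v).symm, (party₂_party₃_comm _ _ v).symm, absurd rfl hij]
  zero_one i := by
    rw [vec_eq]
    fin_cases i
    · change party₁ S.q₁ (party₂ S.p₂ (party₃ S.p₃ _)) = 0
      rw [party₃_tensorVec, party₂_tensorVec, party₁_tensorVec, mul_one, mul_one, mul_one]
      exact S.tensorVec_zero₁ h S.hq₁.exists_left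
    · change party₂ S.q₂ (party₃ S.p₃ (party₁ S.p₁ _)) = 0
      rw [party₁_tensorVec, party₃_tensorVec, party₂_tensorVec, mul_one, mul_one, mul_one]
      exact S.tensorVec_zero₂ h S.hq₂.exists_left
    · change party₃ S.q₃ (party₁ S.p₁ (party₂ S.p₂ _)) = 0
      rw [party₂_tensorVec, party₁_tensorVec, party₃_tensorVec, mul_one, mul_one, mul_one]
      exact S.tensorVec_zero₃ h S.hq₃.exists_left
  zero_all := by
    change IsHardyVector.co S.Q 0 (IsHardyVector.co S.Q 1 (IsHardyVector.co S.Q 2 S.vec)) = 0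
    rw [co_Q_zero, co_Q_one, co_Q_two, vec_eq, party₃_tensorVec, party₂_tensorVec,
      party₁_tensorVec, mul_one, mul_one, mul_one, ← S.hq₁.co_mul_co, ← S.hq₂.co_mul_co,
      ← S.hq₃.co_mul_co]
    exact S.tensorVec_co_eq_zero h _ _ _

theorem expect_eq_norm_event (S : R.Supports) (h : R.SatisfiesHardy) :
    expect R.state S.p₁ S.p₂ S.p₃ = ‖IsHardyVector.event S.P S.vec‖ ^ 2 := by
  rw [norm_sq_eq_re_inner (𝕜 := ℂ), ← (S.isHardyVector h).inner_state_event, event_eq,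
    expect_eq_inner]
  rfl

theorem expect_le (S : R.Supports) (h : R.SatisfiesHardy) :
    expect R.state S.p₁ S.p₂ S.p₃ ≤ 1 / 8 := by
  have := (S.isHardyVector h).event_le.1
  rw [S.norm_vec] at this
  rw [S.expect_eq_norm_event h]
  linarith

/-- Only the other parties' effects are enlarged. At the maximum, comparison with `expect_le` then
leaves no weight for `p₁ - meas₁ 0 1`. -/
theorem hardyProb_le_expect₁ (S : R.Supports) :
    R.hardyProb ≤ expect R.state (R.meas₁ 0 1) S.p₂ S.p₃ := by
  have h1 := expect_nonneg R.state S.hp₁.posSemidef_effect S.hp₂.posSemidef_sub S.hp₃.posSemidef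
  have h2 := expect_nonneg R.state S.hp₁.posSemidef_effect S.hp₂.posSemidef_effect
    S.hp₃.posSemidef_sub
  rw [expect_sub_mid] at h1
  rw [expect_sub_right] at h2
  have h3 : R.hardyProb = expect R.state (R.meas₁ 0 1) (R.meas₂ 0 1) (R.meas₃ 0 1) := rfl
  linarith

theorem hardyProb_le_expect₂ (S : R.Supports) :
    R.hardyProb ≤ expect R.state S.p₁ (R.meas₂ 0 1) S.p₃ := by
  have h1 := expect_nonneg R.state S.hp₁.posSemidef_sub S.hp₂.posSemidef_effect S.hp₃.posSemidef
  have h2 := expect_nonneg R.state S.hp₁.posSemidef_effect S.hp₂.posSemidef_effect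
    S.hp₃.posSemidef_sub
  rw [expect_sub_left] at h1
  rw [expect_sub_right] at h2
  have h3 : R.hardyProb = expect R.state (R.meas₁ 0 1) (R.meas₂ 0 1) (R.meas₃ 0 1) := rfl
  linarith

theorem hardyProb_le_expect₃ (S : R.Supports) :
    R.hardyProb ≤ expect R.state S.p₁ S.p₂ (R.meas₃ 0 1) := by
  have h1 := expect_nonneg R.state S.hp₁.posSemidef_sub S.hp₂.posSemidef S.hp₃.posSemidef_effect
  have h2 := expect_nonneg R.state S.hp₁.posSemidef_effect S.hp₂.posSemidef_sub
    S.hp₃.posSemidef_effect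
  rw [expect_sub_left] at h1
  rw [expect_sub_mid] at h2
  have h3 : R.hardyProb = expect R.state (R.meas₁ 0 1) (R.meas₂ 0 1) (R.meas₃ 0 1) := rfl
  linarith

theorem expect_sub₁_nonneg (S : R.Supports) :
    0 ≤ expect R.state (S.p₁ - R.meas₁ 0 1) S.p₂ S.p₃ :=
  expect_nonneg R.state S.hp₁.posSemidef_sub S.hp₂.posSemidef S.hp₃.posSemidef

theorem hardyProb_le (S : R.Supports) (h : R.SatisfiesHardy) : R.hardyProb ≤ 1 / 8 := by
  have h1 := S.expect_sub₁_nonneg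
  rw [expect_sub_left] at h1
  linarith [S.hardyProb_le_expect₁, S.expect_le h]

theorem isOptimal (S : R.Supports) (h : R.SatisfiesHardy) (hp : R.hardyProb = 1 / 8) :
    IsHardyVector.IsOptimal S.P S.Q S.vec := by
  refine (S.isHardyVector h).isOptimal ?_
  have h1 := S.expect_sub₁_nonneg
  rw [expect_sub_left] at h1
  have h2 := S.expect_le h
  have h3 := S.hardyProb_le_expect₁
  rw [S.norm_vec, ← S.expect_eq_norm_event h]
  linarith

/-- For setting 0, saturation makes `p₁ - E` kill `cond 0`, and `(p₁ - E) p₁ = p₁ - E` carries this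
to `event`. For setting 1, both `q₁` and its effect `F` kill `cond 0`, and `q₁ - F = q₁ (1 - F)`
brings in the constraint on three failures. -/
theorem isMatched₁ (S : R.Supports) (h : R.SatisfiesHardy) (hp : R.hardyProb = 1 / 8) :
    IsMatched party₁ S.vec R.meas₁ S.p₁ S.q₁ := by
  have hopt := S.isOptimal h hp
  have hcQ (A : Matrix (Fin d₁) (Fin d₁) ℂ) (j : Fin 3) (hj : j ≠ 0) (v) :
      party₁ A (S.Q j v) = S.Q j (party₁ A v) := by
    fin_cases j
    exacts [absurd rfl hj, party₁_party₂_comm _ _ v, party₁_party₃_comm _ _ v]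
  have hcP (A : Matrix (Fin d₁) (Fin d₁) ℂ) (j : Fin 3) (hj : j ≠ 0) (v) :
      party₁ A (S.P j v) = S.P j (party₁ A v) := by
    fin_cases j
    exacts [absurd rfl hj, party₁_party₂_comm _ _ v, party₁_party₃_comm _ _ v]
  have hcond (A : Matrix (Fin d₁) (Fin d₁) ℂ) :
      party₁ A (IsHardyVector.cond S.P S.vec 0) = tensorVec R.state A S.p₂ S.p₃ := by
    change party₁ A (party₂ S.p₂ (party₃ S.p₃ S.vec)) = _
    rw [vec_eq, party₃_tensorVec, party₂_tensorVec, party₁_tensorVec, mul_one, mul_one, mul_one]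
  constructor
  · have hz : tensorVec R.state (S.p₁ - R.meas₁ 0 1) S.p₂ S.p₃ = 0 := by
      refine tensorVec_eq_zero_of_expect _ S.hp₁.posSemidef_sub S.hp₂.posSemidef S.hp₃.posSemidef
        (le_antisymm ?_ S.expect_sub₁_nonneg)
      rw [expect_sub_left]
      linarith [S.hardyProb_le_expect₁, S.expect_le h]
    refine hopt.eq_zero_of_commute 0 (hcQ _) ((hcond _).trans hz) ?_
    rw [event_eq, party₁_tensorVec, S.hp₁.sub_mul_proj, hz]
  · refine hopt.eq_zero_of_constraints 0 (hcP _) (hcQ _) ?_ ?_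
    · rw [hcond, tensorVec_sub_left, S.tensorVec_zero₁ h S.hq₁.exists_left,
        S.tensorVec_zero₁ h ⟨1, one_mul _⟩, sub_zero]
    · change party₁ _ (IsHardyVector.co S.Q 1 (IsHardyVector.co S.Q 2 S.vec)) = 0
      rw [co_Q_one, co_Q_two, vec_eq, party₃_tensorVec, party₂_tensorVec, party₁_tensorVec,
        mul_one, mul_one, mul_one, ← S.hq₁.proj_mul_co, ← S.hq₂.co_mul_co, ← S.hq₃.co_mul_co]
      exact S.tensorVec_co_eq_zero h _ _ _
  · have := hopt.jordanOp_state 0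
    rw [map_sub, LinearMap.sub_apply, map_smul, map_one]
    refine sub_eq_zero.mpr (Eq.trans ?_ this)
    simp only [map_add, map_sub, map_mul, map_one]
    rfl

theorem isMatched₂ (S : R.Supports) (h : R.SatisfiesHardy) (hp : R.hardyProb = 1 / 8) :
    IsMatched party₂ S.vec R.meas₂ S.p₂ S.q₂ := by
  have hopt := S.isOptimal h hp
  have hcQ (A : Matrix (Fin d₂) (Fin d₂) ℂ) (j : Fin 3) (hj : j ≠ 1) (v) :
      party₂ A (S.Q j v) = S.Q j (party₂ A v) := by
    fin_cases j
    exacts [(party₁_party₂_comm _ _ v).symm, absurd rfl hj, party₂_party₃_comm _ _ v]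
  have hcP (A : Matrix (Fin d₂) (Fin d₂) ℂ) (j : Fin 3) (hj : j ≠ 1) (v) :
      party₂ A (S.P j v) = S.P j (party₂ A v) := by
    fin_cases j
    exacts [(party₁_party₂_comm _ _ v).symm, absurd rfl hj, party₂_party₃_comm _ _ v]
  have hcond (A : Matrix (Fin d₂) (Fin d₂) ℂ) :
      party₂ A (IsHardyVector.cond S.P S.vec 1) = tensorVec R.state S.p₁ A S.p₃ := by
    change party₂ A (party₃ S.p₃ (party₁ S.p₁ S.vec)) = _
    rw [vec_eq, party₁_tensorVec, party₃_tensorVec, party₂_tensorVec, mul_one, mul_one, mul_one]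
  constructor
  · have hz : tensorVec R.state S.p₁ (S.p₂ - R.meas₂ 0 1) S.p₃ = 0 := by
      refine tensorVec_eq_zero_of_expect _ S.hp₁.posSemidef S.hp₂.posSemidef_sub S.hp₃.posSemidef
        (le_antisymm ?_
          (expect_nonneg _ S.hp₁.posSemidef S.hp₂.posSemidef_sub S.hp₃.posSemidef))
      rw [expect_sub_mid]
      linarith [S.hardyProb_le_expect₂, S.expect_le h]
    refine hopt.eq_zero_of_commute 1 (hcQ _) ((hcond _).trans hz) ?_
    rw [event_eq, party₂_tensorVec, S.hp₂.sub_mul_proj, hz]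
  · refine hopt.eq_zero_of_constraints 1 (hcP _) (hcQ _) ?_ ?_
    · rw [hcond, tensorVec_sub_mid, S.tensorVec_zero₂ h S.hq₂.exists_left,
        S.tensorVec_zero₂ h ⟨1, one_mul _⟩, sub_zero]
    · change party₂ _ (IsHardyVector.co S.Q 2 (IsHardyVector.co S.Q 0 S.vec)) = 0
      rw [co_Q_zero, co_Q_two, vec_eq, party₁_tensorVec, party₃_tensorVec, party₂_tensorVec,
        mul_one, mul_one, mul_one, ← S.hq₂.proj_mul_co, ← S.hq₁.co_mul_co, ← S.hq₃.co_mul_co]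
      exact S.tensorVec_co_eq_zero h _ _ _
  · have := hopt.jordanOp_state 1
    rw [map_sub, LinearMap.sub_apply, map_smul, map_one]
    refine sub_eq_zero.mpr (Eq.trans ?_ this)
    simp only [map_add, map_sub, map_mul, map_one]
    rfl

theorem isMatched₃ (S : R.Supports) (h : R.SatisfiesHardy) (hp : R.hardyProb = 1 / 8) :
    IsMatched party₃ S.vec R.meas₃ S.p₃ S.q₃ := by
  have hopt := S.isOptimal h hp
  have hcQ (A : Matrix (Fin d₃) (Fin d₃) ℂ) (j : Fin 3) (hj : j ≠ 2) (v) :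
      party₃ A (S.Q j v) = S.Q j (party₃ A v) := by
    fin_cases j
    exacts [(party₁_party₃_comm _ _ v).symm, (party₂_party₃_comm _ _ v).symm, absurd rfl hj]
  have hcP (A : Matrix (Fin d₃) (Fin d₃) ℂ) (j : Fin 3) (hj : j ≠ 2) (v) :
      party₃ A (S.P j v) = S.P j (party₃ A v) := by
    fin_cases j
    exacts [(party₁_party₃_comm _ _ v).symm, (party₂_party₃_comm _ _ v).symm, absurd rfl hj]
  have hcond (A : Matrix (Fin d₃) (Fin d₃) ℂ) :
      party₃ A (IsHardyVector.cond S.P S.vec 2) = tensorVec R.state S.p₁ S.p₂ A := by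
    change party₃ A (party₁ S.p₁ (party₂ S.p₂ S.vec)) = _
    rw [vec_eq, party₂_tensorVec, party₁_tensorVec, party₃_tensorVec, mul_one, mul_one, mul_one]
  constructor
  · have hz : tensorVec R.state S.p₁ S.p₂ (S.p₃ - R.meas₃ 0 1) = 0 := by
      refine tensorVec_eq_zero_of_expect _ S.hp₁.posSemidef S.hp₂.posSemidef S.hp₃.posSemidef_sub
        (le_antisymm ?_
          (expect_nonneg _ S.hp₁.posSemidef S.hp₂.posSemidef S.hp₃.posSemidef_sub))
      rw [expect_sub_right]
      linarith [S.hardyProb_le_expect₃, S.expect_le h]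
    refine hopt.eq_zero_of_commute 2 (hcQ _) ((hcond _).trans hz) ?_
    rw [event_eq, party₃_tensorVec, S.hp₃.sub_mul_proj, hz]
  · refine hopt.eq_zero_of_constraints 2 (hcP _) (hcQ _) ?_ ?_
    · rw [hcond, tensorVec_sub_right, S.tensorVec_zero₃ h S.hq₃.exists_left,
        S.tensorVec_zero₃ h ⟨1, one_mul _⟩, sub_zero]
    · change party₃ _ (IsHardyVector.co S.Q 0 (IsHardyVector.co S.Q 1 S.vec)) = 0
      rw [co_Q_zero, co_Q_one, vec_eq, party₂_tensorVec, party₁_tensorVec, party₃_tensorVec,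
        mul_one, mul_one, mul_one, ← S.hq₃.proj_mul_co, ← S.hq₁.co_mul_co, ← S.hq₂.co_mul_co]
      exact S.tensorVec_co_eq_zero h _ _ _
  · have := hopt.jordanOp_state 2
    rw [map_sub, LinearMap.sub_apply, map_smul, map_one]
    refine sub_eq_zero.mpr (Eq.trans ?_ this)
    simp only [map_add, map_sub, map_mul, map_one]
    rfl

end Realization.Supports
end

end HardyGHZ

/-! ### Extraction of GHZ, and the reference realization. -/

namespace HardyGHZ

section

open scoped Kronecker ComplexOrder InnerProductSpace

variable {d₁ d₂ d₃ : ℕ}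

theorem tensorVec_eq_party (ψ : Fin d₁ × Fin d₂ × Fin d₃ → ℂ) (A : Matrix (Fin d₁) (Fin d₁) ℂ)
    (B : Matrix (Fin d₂) (Fin d₂) ℂ) (C : Matrix (Fin d₃) (Fin d₃) ℂ) :
    tensorVec ψ A B C = party₁ A (party₂ B (party₃ C (WithLp.toLp 2 ψ))) := by
  rw [← tensorVec_one, party₃_tensorVec, party₂_tensorVec, party₁_tensorVec, mul_one, mul_one,
    mul_one]

/-- Operators of the three parties may be replaced by operators that act in the same way. -/
theorem tensorVec_congr {ψ : Fin d₁ × Fin d₂ × Fin d₃ → ℂ} {A A' : Matrix (Fin d₁) (Fin d₁) ℂ}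
    {B B' : Matrix (Fin d₂) (Fin d₂) ℂ} {C C' : Matrix (Fin d₃) (Fin d₃) ℂ}
    (hA : party₁ (A - A') (WithLp.toLp 2 ψ) = 0) (hB : party₂ (B - B') (WithLp.toLp 2 ψ) = 0)
    (hC : party₃ (C - C') (WithLp.toLp 2 ψ) = 0) :
    tensorVec ψ A B C = tensorVec ψ A' B' C' := by
  rw [map_sub, LinearMap.sub_apply, sub_eq_zero] at hA hB hC
  rw [tensorVec_eq_party, tensorVec_eq_party, hC, party₂_party₃_comm, hB, party₁_party₃_comm,
    party₁_party₂_comm, hA, ← party₁_party₂_comm, ← party₁_party₃_comm, ← party₂_party₃_comm]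

namespace Realization.Supports

variable {R : Realization d₁ d₂ d₃}

/-- The junk state left over by the local isometries. -/
noncomputable def junk (S : R.Supports) : Fin d₁ × Fin d₂ × Fin d₃ → ℂ := fun i =>
  2 * (1 + Complex.I) * IsHardyVector.event S.P S.vec i

theorem norm_junk (S : R.Supports) (h : R.SatisfiesHardy) (hp : R.hardyProb = 1 / 8) :
    ∑ j, ‖S.junk j‖ ^ 2 = 1 := by
  have h1 := S.expect_sub₁_nonneg
  rw [expect_sub_left] at h1
  have h2 := S.expect_le h
  have h3 := S.hardyProb_le_expect₁
  have h4 : ‖IsHardyVector.event S.P S.vec‖ ^ 2 = 1 / 8 := by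
    rw [← S.expect_eq_norm_event h]; linarith
  have h5 : ‖2 * (1 + Complex.I)‖ ^ 2 = 8 := by
    rw [← Complex.normSq_eq_norm_sq]
    simp [Complex.normSq_apply]
    norm_num
  rw [EuclideanSpace.norm_sq_eq] at h4
  simp only [junk, norm_mul _ (IsHardyVector.event S.P S.vec _), mul_pow]
  rw [h5, ← Finset.mul_sum, h4]
  norm_num

theorem map_branchMatrix {n H : Type*} [Fintype n] [DecidableEq n] [NormedAddCommGroup H]
    [InnerProductSpace ℂ H] (L : Matrix n n ℂ →ₐ[ℂ] Module.End ℂ H) {p q : Matrix n n ℂ}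
    {P Q : Fin 3 → Module.End ℂ H} {i : Fin 3} (hP : P i = L p) (hQ : Q i = L q) (s : Fin 2) :
    L (branchMatrix p q s) = IsHardyVector.branch P Q i s := by
  fin_cases s
  · exact hP.symm
  · change L (((2 : ℂ) • q - 1) * (1 - p)) = (2 * Q i - 1) * (1 - P i)
    rw [hP, hQ, map_mul, map_sub, map_sub, map_one, map_smul, two_smul, two_mul]

/-- Expanding the three blocks over branches makes every term a multiple of `event`; the
coefficients sum to GHZ. -/
theorem tensorVec_isometryBlock (S : R.Supports) (h : R.SatisfiesHardy)
    (hp : R.hardyProb = 1 / 8) (k₁ k₂ k₃ : Fin 2) :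
    tensorVec R.state (isometryBlock S.p₁ S.q₁ k₁) (isometryBlock S.p₂ S.q₂ k₂)
      (isometryBlock S.p₃ S.q₃ k₃) =
    (ghzState (k₁, k₂, k₃) * (2 * (1 + Complex.I))) • IsHardyVector.event S.P S.vec := by
  have hbr (a b c : Fin 2) : party₁ (branchMatrix S.p₁ S.q₁ a) (party₂ (branchMatrix S.p₂ S.q₂ b)
      (party₃ (branchMatrix S.p₃ S.q₃ c) (WithLp.toLp 2 R.state))) =
      IsHardyVector.branchSign a b c • IsHardyVector.event S.P S.vec := by
    rw [map_branchMatrix party₁ (P := S.P) (Q := S.Q) (i := 0) rfl rfl,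
      map_branchMatrix party₂ (P := S.P) (Q := S.Q) (i := 1) rfl rfl,
      map_branchMatrix party₃ (P := S.P) (Q := S.Q) (i := 2) rfl rfl]
    exact (S.isOptimal h hp).branch_state 0 a b c
  rw [tensorVec_eq_party, ← ghzState_eq_sum]
  simp only [isometryBlock, Fin.sum_univ_two, map_add, map_smul, LinearMap.add_apply,
    LinearMap.smul_apply, hbr]
  module

theorem mulVec_localIsometry (S : R.Supports) (φ : Fin d₁ × Fin d₂ × Fin d₃ → ℂ)
    (j₁ j₂ j₃ q₁ q₂ q₃) :
    Matrix.mulVec (localIsometry S.p₁ S.q₁ ⊗ₖ (localIsometry S.p₂ S.q₂ ⊗ₖ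
      localIsometry S.p₃ S.q₃)) φ ((j₁, q₁), (j₂, q₂), (j₃, q₃)) =
    tensorVec φ (isometryBlock S.p₁ S.q₁ q₁) (isometryBlock S.p₂ S.q₂ q₂)
      (isometryBlock S.p₃ S.q₃ q₃) (j₁, j₂, j₃) := rfl

theorem equivUpToLocalIsometries (S : R.Supports) (h : R.SatisfiesHardy)
    (hp : R.hardyProb = 1 / 8) : R.EquivUpToLocalIsometries ghzRealization := by
  refine ⟨d₁, d₂, d₃, localIsometry S.p₁ S.q₁, localIsometry S.p₂ S.q₂, localIsometry S.p₃ S.q₃,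
    S.junk, localIsometry_isometry S.hp₁.herm S.hp₁.idem S.hq₁.herm S.hq₁.idem,
    localIsometry_isometry S.hp₂.herm S.hp₂.idem S.hq₂.herm S.hq₂.idem,
    localIsometry_isometry S.hp₃.herm S.hp₃.idem S.hq₃.herm S.hq₃.idem, S.norm_junk h hp, ?_, ?_⟩
  · intro j₁ j₂ j₃ q₁ q₂ q₃
    rw [mulVec_localIsometry, S.tensorVec_isometryBlock h hp, junk]
    rw [PiLp.smul_apply, smul_eq_mul]
    change _ = _ * ghzState _
    ring
  · intro a₁ a₂ a₃ x₁ x₂ x₃ j₁ j₂ j₃ q₁ q₂ q₃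
    have h1 : tensorVec (R.measured a₁ a₂ a₃ x₁ x₂ x₃) (isometryBlock S.p₁ S.q₁ q₁)
        (isometryBlock S.p₂ S.q₂ q₂) (isometryBlock S.p₃ S.q₃ q₃) =
        tensorVec R.state (isometryBlock S.p₁ S.q₁ q₁ * R.meas₁ x₁ a₁)
          (isometryBlock S.p₂ S.q₂ q₂ * R.meas₂ x₂ a₂)
          (isometryBlock S.p₃ S.q₃ q₃ * R.meas₃ x₃ a₃) := by
      rw [tensorVec, Realization.measured, Matrix.mulVec_mulVec, ← Matrix.mul_kronecker_mul,
        ← Matrix.mul_kronecker_mul, tensorVec]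
    rw [mulVec_localIsometry, h1, tensorVec_congr
      ((S.isMatched₁ h hp).intertwine R.isMeasurement₁ S.hp₁.idem S.hq₁.idem x₁ a₁ q₁)
      ((S.isMatched₂ h hp).intertwine R.isMeasurement₂ S.hp₂.idem S.hq₂.idem x₂ a₂ q₂)
      ((S.isMatched₃ h hp).intertwine R.isMeasurement₃ S.hp₃.idem S.hq₃.idem x₃ a₃ q₃)]
    have h2 : tensorVec R.state (∑ k, ghzMeas x₁ a₁ q₁ k • isometryBlock S.p₁ S.q₁ k)
        (∑ k, ghzMeas x₂ a₂ q₂ k • isometryBlock S.p₂ S.q₂ k)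
        (∑ k, ghzMeas x₃ a₃ q₃ k • isometryBlock S.p₃ S.q₃ k) =
        (ghzRealization.measured a₁ a₂ a₃ x₁ x₂ x₃ (q₁, q₂, q₃) * (2 * (1 + Complex.I))) •
          IsHardyVector.event S.P S.vec := by
      have h3 : ghzRealization.measured a₁ a₂ a₃ x₁ x₂ x₃ (q₁, q₂, q₃) =
          ∑ k₁, ∑ k₂, ∑ k₃, ghzMeas x₁ a₁ q₁ k₁ * (ghzMeas x₂ a₂ q₂ k₂ * ghzMeas x₃ a₃ q₃ k₃)
            * ghzState (k₁, k₂, k₃) := by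
        simp only [Realization.measured, Matrix.mulVec, dotProduct, Fintype.sum_prod_type]
        rfl
      have h4 (k₁ k₂ k₃) := S.tensorVec_isometryBlock h hp k₁ k₂ k₃
      simp only [tensorVec_eq_party] at h4 ⊢
      rw [h3]
      simp only [Fin.sum_univ_two, map_add, map_smul, LinearMap.add_apply, LinearMap.smul_apply, h4]
      module
    rw [h2, junk, PiLp.smul_apply, smul_eq_mul]
    ring

end Realization.Supports

/-- For equatorial measurements on GHZ all one- and two-party correlators vanish, and the full
correlator is the cosine of the total angle. The Hardy settings give total angles `π/2`, `π` and
`2π`. -/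
theorem ghzRealization_prob (a₁ a₂ a₃ : ℤˣ) (x₁ x₂ x₃ : Fin 2) :
    ghzRealization.prob a₁ a₂ a₃ x₁ x₂ x₃ =
      (1 + (a₁ : ℤ) * (a₂ : ℤ) * (a₃ : ℤ) *
        Real.cos (ghzAngle x₁ + ghzAngle x₂ + ghzAngle x₃)) / 8 := by
  have h : star ghzRealization.state ⬝ᵥ ghzRealization.measured a₁ a₂ a₃ x₁ x₂ x₃ =
      ((1 + (a₁ : ℤ) * (a₂ : ℤ) * (a₃ : ℤ) *
        Real.cos (ghzAngle x₁ + ghzAngle x₂ + ghzAngle x₃)) / 8 : ℝ) := by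
    have hc := invSqrtTwo_mul_self
    have hs (q) : ghzState q = if q = (0, 0, 0) ∨ q = (1, 1, 1) then invSqrtTwo else 0 := rfl
    have he (θ : ℝ) : Complex.exp (-(θ * Complex.I)) = (Complex.exp (θ * Complex.I))⁻¹ :=
      Complex.exp_neg _
    have hcos : ((Real.cos (ghzAngle x₁ + ghzAngle x₂ + ghzAngle x₃) : ℝ) : ℂ) =
        (Complex.exp (ghzAngle x₁ * Complex.I) * Complex.exp (ghzAngle x₂ * Complex.I)
          * Complex.exp (ghzAngle x₃ * Complex.I) +
        (Complex.exp (ghzAngle x₁ * Complex.I))⁻¹ * (Complex.exp (ghzAngle x₂ * Complex.I))⁻¹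
          * (Complex.exp (ghzAngle x₃ * Complex.I))⁻¹) / 2 := by
      rw [Complex.ofReal_cos, Complex.cos]
      simp only [← Complex.exp_neg, ← Complex.exp_add]
      push_cast
      ring_nf
    simp only [Complex.ofReal_div, Complex.ofReal_add, Complex.ofReal_mul, hcos]
    simp [Realization.measured, ghzRealization, Matrix.mulVec, dotProduct, Fintype.sum_prod_type,
      Fin.sum_univ_two, hs, ghzMeas, equatorial, he, conj_invSqrtTwo]
    generalize Complex.exp (ghzAngle x₁ * Complex.I) = u
    generalize Complex.exp (ghzAngle x₂ * Complex.I) = v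
    generalize Complex.exp (ghzAngle x₃ * Complex.I) = w
    linear_combination (2 + (a₁ : ℤ) * (a₂ : ℤ) * (a₃ : ℤ) * (u * v * w + u⁻¹ * v⁻¹ * w⁻¹)) / 8 * hc
  rw [Realization.prob, h, Complex.ofReal_re]

theorem ghzRealization_hardyProb : ghzRealization.hardyProb = 1 / 8 := by
  rw [Realization.hardyProb, ghzRealization_prob]
  have : ghzAngle 0 + ghzAngle 0 + ghzAngle 0 = Real.pi / 2 := by
    simp only [ghzAngle, if_true]; ring
  rw [this, Real.cos_pi_div_two]
  norm_num

theorem ghzRealization_satisfiesHardy : ghzRealization.SatisfiesHardy := by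
  have h0 : ghzAngle 0 = Real.pi / 6 := rfl
  have h1 : ghzAngle 1 = 2 * Real.pi / 3 := rfl
  constructor <;> rw [ghzRealization_prob, h1] <;> try rw [h0]
  · rw [show 2 * Real.pi / 3 + Real.pi / 6 + Real.pi / 6 = Real.pi by ring, Real.cos_pi]
    norm_num
  · rw [show Real.pi / 6 + 2 * Real.pi / 3 + Real.pi / 6 = Real.pi by ring, Real.cos_pi]
    norm_num
  · rw [show Real.pi / 6 + Real.pi / 6 + 2 * Real.pi / 3 = Real.pi by ring, Real.cos_pi]
    norm_num
  · rw [show 2 * Real.pi / 3 + 2 * Real.pi / 3 + 2 * Real.pi / 3 = 2 * Real.pi by ring,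
      Real.cos_two_pi]
    norm_num

end

end HardyGHZ

theorem theorem2 :
    -- `1/8` is the maximal Hardy success probability over all finite-dimensional realizations
    IsGreatest {p : ℝ | ∃ (d₁ d₂ d₃ : ℕ) (R : HardyGHZ.Realization d₁ d₂ d₃),
      R.SatisfiesHardy ∧ R.hardyProb = p} (1 / 8) ∧
    -- the GHZ state attains it
    (HardyGHZ.ghzRealization.SatisfiesHardy ∧ HardyGHZ.ghzRealization.hardyProb = 1 / 8) ∧
    -- every realization that attains it is the GHZ realization up to local isometries
    (∀ (d₁ d₂ d₃ : ℕ) (R : HardyGHZ.Realization d₁ d₂ d₃),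
      R.SatisfiesHardy → R.hardyProb = 1 / 8 →
        R.EquivUpToLocalIsometries HardyGHZ.ghzRealization) := by
  refine ⟨⟨⟨2, 2, 2, HardyGHZ.ghzRealization, HardyGHZ.ghzRealization_satisfiesHardy,
    HardyGHZ.ghzRealization_hardyProb⟩, ?_⟩, ⟨HardyGHZ.ghzRealization_satisfiesHardy,
    HardyGHZ.ghzRealization_hardyProb⟩, fun d₁ d₂ d₃ R h hp => ?_⟩
  · rintro p ⟨d₁, d₂, d₃, R, h, rfl⟩
    obtain ⟨S⟩ := R.nonempty_supports
    exact S.hardyProb_le h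
  · obtain ⟨S⟩ := R.nonempty_supports
    exact S.equivUpToLocalIsometries h hp
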